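/- **Clebsch representation with material vortex-line variables.** Consider a smooth motion of a frictionless fluid in $\mathbb R^3$: during an open time interval $I\ni 0$ the particle that is at $a$ at time $0$ ($a$ ranging over an open set $B\subseteq\mathbb R^3$) is at $X_t(a)$ at time $t$, where $X$ is $C^\infty$ on $I\times B$, $X_0=\mathrm{id}$, each $X_t$ is injective, and $\det DX_t>0$. Let $D=\{(t,x): t\in I,\ x\in X_t(B)\}$ and let the velocity $u$, the density $\varrho>0$, the pressure $p$ and the force potential $V$ be $C^\infty$ functions on $D$ with $$\partial_tX_t(a)=u(t,X_t(a)),\qquad \varrho\,\bigl(\partial_t u+(u\cdot\nabla)u-\nabla V\bigr)+\nabla p=0,\qquad \partial_t\varrho+\operatorname{div}(\varrho u)=0 .$$ Assume that the fluid is either a liquid ($\varrho$ is constant) or elastic ($\varrho=G(p)$ with $G$ a $C^\infty$ positive function on an open interval containing all values of $p$). Let $a_0\in B$ be a rotating particle, that is, $\operatorname{curl}u(t_0,\cdot)\ne0$ at $X_{t_0}(a_0)$ for some $t_0\in I$. Then there are an open set $U$ of particles with $a_0\in U\subseteq B$ and $C^\infty$ functions $F,\varphi,\psi$ on $D_U=\{(t,x):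 t\in I,\ x\in X_t(U)\}$ such that the following hold. 1. $u=\nabla F+\varphi\nabla\psi$ on $D_U$. 2. At every time $t\in I$, $\varphi=\mathrm{const}$ and $\psi=\mathrm{const}$ are the equations of the vortex lines in $X_t(U)$: two points of $X_t(U)$ have the same value of $\varphi(t,\cdot)$ and the same value of $\psi(t,\cdot)$ if and only if they lie on a common vortex line in $X_t(U)$. Here a vortex line in $X_t(U)$ is a $C^1$ curve $\gamma:\mathbb R\to X_t(U)$ with nowhere vanishing derivative, everywhere a multiple of $\operatorname{curl}u(t,\cdot)$. 3. Along the flow, $d\varphi/dt=d\psi/dt=0$: for every $a\in U$ the functions $t\mapsto\varphi(t,X_t(a))$ and $t\mapsto\psi(t,X_t(a))$ have derivative $0$ on $I$. 4. On $D_U$ one has $$\partial_t\varphi+\nabla\varphi\cdot(\nabla F+\varphi\nabla\psi)=0,\qquad \partial_t\psi+\nabla\psi\cdot(\nabla F+\varphi\nabla\psi)=0,\qquad \partial_t\varrho+\operatorname{div}\bigl(\varrho(\nabla F+\varphi\nabla\psi)\bigr)=0 ,$$ and, if the fluid is a liquid, the last equation becomes $\operatorname{div}(\nabla F+\varphi\nabla\psi)=0$.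 -/

import Mathlib

open scoped ContDiff Gradient

noncomputable section

/-- Euclidean three-space. -/
abbrev E3 : Type := EuclideanSpace ℝ (Fin 3)

/-- `partialD v j i x` is the partial derivative `∂ vᵢ / ∂ xⱼ` at `x`. -/
def partialD (v : E3 → E3) (j i : Fin 3) (x : E3) : ℝ :=
  (fderiv ℝ v x (EuclideanSpace.single j 1)) i

/-- The curl of a vector field; the rotational velocity is half of it (up to the sign
convention), so that it is parallel to the instantaneous axis of rotation. -/
def curl (v : E3 → E3) (x : E3) : E3 :=
  !₂[partialD v 1 2 x - partialD v 2 1 x,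
     partialD v 2 0 x - partialD v 0 2 x,
     partialD v 0 1 x - partialD v 1 0 x]

/-- The divergence of a vector field. -/
def divergence (v : E3 → E3) (x : E3) : ℝ := ∑ i, partialD v i i x

/-- A smooth motion of a continuum: during an open time interval containing `0`, the particle
which at time `0` is at `a` is at time `t` at `X t a`. -/
structure FluidMotion where
  /-- the time interval -/
  times : Set ℝ
  times_open : IsOpen times
  times_interval : times.OrdConnected
  zero_mem : (0 : ℝ) ∈ times
  /-- the initial positions of the particles, which serve as their labels -/
  particles : Set E3
  particles_open : IsOpen particles
  /-- the position of a particle at a given time -/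
  X : ℝ → E3 → E3
  smooth : ContDiffOn ℝ ∞ (Function.uncurry X) (times ×ˢ particles)
  initial : ∀ a ∈ particles, X 0 a = a
  injective : ∀ t ∈ times, Set.InjOn (X t) particles
  jacobian_pos : ∀ t ∈ times, ∀ a ∈ particles, 0 < (fderiv ℝ (X t) a).det

namespace FluidMotion

/-- The region of space-time swept out by the particles of `U`. -/
def tube (M : FluidMotion) (U : Set E3) : Set (ℝ × E3) :=
  {q | q.1 ∈ M.times ∧ q.2 ∈ M.X q.1 '' U}

/-- The region of space-time filled by the whole fluid. -/
def region (M : FluidMotion) : Set (ℝ × E3) := M.tube M.particles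

end FluidMotion

/-- The fluid moving by `M` has the velocity field `u`, density `ρ` and pressure `p`, and obeys
Euler's equations without friction under accelerating forces with potential `V`
(the force being `∇ V`), and the density equation. -/
structure IsIdealFlow (M : FluidMotion) (u : ℝ → E3 → E3) (ρ p V : ℝ → E3 → ℝ) : Prop where
  smooth_velocity : ContDiffOn ℝ ∞ (Function.uncurry u) M.region
  smooth_density : ContDiffOn ℝ ∞ (Function.uncurry ρ) M.region
  smooth_pressure : ContDiffOn ℝ ∞ (Function.uncurry p) M.region
  smooth_potential : ContDiffOn ℝ ∞ (Function.uncurry V) M.region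
  density_pos : ∀ t x, (t, x) ∈ M.region → 0 < ρ t x
  velocity : ∀ t ∈ M.times, ∀ a ∈ M.particles,
    HasDerivAt (fun s => M.X s a) (u t (M.X t a)) t
  euler : ∀ t x, (t, x) ∈ M.region →
    ρ t x • (deriv (fun s => u s x) t + fderiv ℝ (u t) x (u t x) - ∇ (V t) x) + ∇ (p t) x = 0
  continuity : ∀ t x, (t, x) ∈ M.region →
    deriv (fun s => ρ s x) t + divergence (fun y => ρ t y • u t y) x = 0

/-- Liquid (incompressible) fluid: the density is a constant. -/
def IsLiquid (M : FluidMotion) (ρ : ℝ → E3 → ℝ) : Prop :=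
  ∃ ρ₀ : ℝ, ∀ t x, (t, x) ∈ M.region → ρ t x = ρ₀

/-- Elastic fluid: the density is a given smooth positive function of the pressure, on an open
interval that contains the occurring pressures. -/
def IsElastic (M : FluidMotion) (ρ p : ℝ → E3 → ℝ) : Prop :=
  ∃ (J : Set ℝ) (G : ℝ → ℝ), IsOpen J ∧ J.OrdConnected ∧ ContDiffOn ℝ ∞ G J ∧
    (∀ s ∈ J, 0 < G s) ∧ ∀ t x, (t, x) ∈ M.region → p t x ∈ J ∧ ρ t x = G (p t x)

/-- A vortex line of the velocity field `v` lying in `R`: a regular curve whose direction is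
everywhere that of the instantaneous axis of rotation. -/
def IsVortexLine (v : E3 → E3) (R : Set E3) (γ : ℝ → E3) : Prop :=
  ContDiff ℝ 1 γ ∧
    ∀ s, γ s ∈ R ∧ deriv γ s ≠ 0 ∧ ∃ c : ℝ, deriv γ s = c • curl v (γ s)

/-- `f = const`, `g = const` are the equations of the vortex lines of `v` in `R`: two points of
`R` lie on a common vortex line in `R` iff `f` and `g` take equal values at them. -/
def AreEquationsOfVortexLines (v : E3 → E3) (R : Set E3) (f g : E3 → ℝ) : Prop :=
  ∀ x ∈ R, ∀ y ∈ R, (f x = f y ∧ g x = g y) ↔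
    ∃ γ : ℝ → E3, IsVortexLine v R γ ∧ x ∈ Set.range γ ∧ y ∈ Set.range γ

/-- The field `∇F + φ ∇ψ` (spatial gradients) at time `t`. -/
def clebschField (F φ ψ : ℝ → E3 → ℝ) (t : ℝ) (x : E3) : E3 :=
  ∇ (F t) x + φ t x • ∇ (ψ t) x

end

/-! The velocity is treated as a 1-form u♭ and pulled back to the particle labels. By Euler's
equation the time derivative of X_t^*(u_t♭) is exact: it is the differential of (V − P + |u|²/2) ∘
X_t, where dp = ϱ dP. The law relating ϱ and p provides P. Integration in time gives Weber's
identity X_t^*(u_t♭) = u_0♭ + dχ_t (`IsIdealFlow.exists_weber_potential`). Hence the vorticity form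
d(u♭) is carried along by the motion, and a particle that rotates at one time rotates at every time,
in particular at time 0.

It remains to treat the single field u_0 near a point with curl u_0 ≠ 0 (`exists_local_clebsch`). In
coordinates (s, y₁, y₂) straightening the curl (`exists_flowBox`), d(u_0♭) is annihilated by ∂/∂s.
Integrating first in s and then in y₁ gives u_0♭ = df + φ₀ dψ₀ with ψ₀ = y₂ and φ₀ a function of
(y₁, y₂) alone (`exists_clebsch_normalForm`). As the curl does not vanish, ∂φ₀/∂y₁ ≠ 0, so on a cube
every common level set of φ₀ and ψ₀ is one segment in the direction s, that is, one vortex line.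

At time t, the functions φ and ψ are φ₀ and ψ₀ of the label of the particle, and F is f + χ_t of the
label. Weber's identity and the invertibility of DX_t give u = ∇F + φ∇ψ. Constancy along the motion
is built in, and the transport equations are its Eulerian form. The vortex lines at time t are the
X_t-images of the level curves at time 0. -/

noncomputable section

open Set Filter Topology MeasureTheory Function Interval Metric

/-! ### Calculus: local inverses, integrals with parameters, exterior derivatives of 1-forms. -/

section Calculus

/-- The inverse function theorem for `C^∞` maps, with an inverse smooth on its whole domain. -/
theorem exists_openPartialHomeomorph_contDiffOn {E F : Type*} [NormedAddCommGroup E]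
    [NormedSpace ℝ E] [CompleteSpace E] [NormedAddCommGroup F] [NormedSpace ℝ F] {f : E → F}
    {O : Set E} (hO : IsOpen O) (hf : ContDiffOn ℝ ∞ f O) {a : E} (ha : a ∈ O) (f' : E ≃L[ℝ] F)
    (hf' : HasFDerivAt f (f' : E →L[ℝ] F) a) :
    ∃ e : OpenPartialHomeomorph E F, ⇑e = f ∧ a ∈ e.source ∧ e.source ⊆ O ∧
      ContDiffOn ℝ ∞ e.symm e.target := by
  have hfa := hf.contDiffAt (hO.mem_nhds ha)
  have h1 : (∞ : WithTop ℕ∞) ≠ 0 := by simp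
  -- Invertibility of the derivative is an open condition. Imposing it on the whole source makes the
  -- inverse smooth at every point of the target, not only at f a.
  set W : Set E := O ∩ fderiv ℝ f ⁻¹' range ((↑) : (E ≃L[ℝ] F) → E →L[ℝ] F) with hW
  have hWo : IsOpen W :=
    (hf.continuousOn_fderiv_of_isOpen hO (by simp)).isOpen_inter_preimage hO
      (ContinuousLinearEquiv.isOpen)
  have haW : a ∈ W := ⟨ha, f', hf'.fderiv.symm⟩
  set e₀ := hfa.toOpenPartialHomeomorph f hf' h1
  have hs : (e₀.restrOpen W hWo).source = e₀.source ∩ W := rfl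
  refine ⟨e₀.restrOpen W hWo, rfl, ?_, ?_, ?_⟩
  · exact ⟨hfa.mem_toOpenPartialHomeomorph_source hf' h1, haW⟩
  · rw [hs]; exact inter_subset_right.trans inter_subset_left
  · intro y hy
    have hx : (e₀.restrOpen W hWo).symm y ∈ (e₀.restrOpen W hWo).source :=
      (e₀.restrOpen W hWo).map_target hy
    obtain ⟨-, hxO, g, hg⟩ := hx
    have hfx := hf.contDiffAt (hO.mem_nhds hxO)
    refine ((e₀.restrOpen W hWo).contDiffAt_symm hy (f₀' := g) ?_ hfx).contDiffWithinAt
    rw [hg]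
    exact (hfx.differentiableAt h1).hasFDerivAt

theorem isOpen_setOf_segment_subset {P : Type*} [TopologicalSpace P] {O : Set (ℝ × P)}
    (hO : IsOpen O) : IsOpen {p : P | ∀ τ ∈ Icc (0 : ℝ) 1, (τ, p) ∈ O} := by
  rw [isOpen_iff_mem_nhds]
  intro p hp
  obtain ⟨u, v, -, hv, hu, hpv, huv⟩ :=
    generalized_tube_lemma (isCompact_Icc (a := (0 : ℝ)) (b := 1)) (isCompact_singleton (x := p)) hO
      (by rintro ⟨τ, q⟩ ⟨hτ, rfl⟩; exact hp τ hτ)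
  exact mem_of_superset (hv.mem_nhds (hpv rfl)) fun q hq τ hτ => huv ⟨hu hτ, hq⟩

theorem uIoc_zero_one_subset : Ι (0 : ℝ) 1 ⊆ Icc (0 : ℝ) 1 := by
  rw [uIoc_of_le zero_le_one]; exact Ioc_subset_Icc_self

theorem ContinuousOn.aestronglyMeasurable_uIoc {G : Type*} [NormedAddCommGroup G] {g : ℝ → G}
    (hg : ContinuousOn g (Icc 0 1)) : AEStronglyMeasurable g (volume.restrict (Ι (0 : ℝ) 1)) :=
  (hg.aestronglyMeasurable measurableSet_Icc).mono_measure
    (Measure.restrict_mono uIoc_zero_one_subset le_rfl)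

/-- Differentiation under the integral sign. The derivative is bounded on the compact segment over
p, and the tube lemma extends the bound, increased by 1, to the segments over all nearby parameters;
this constant is the dominating function. -/
theorem hasFDerivAt_integral_of_contDiffOn {P F : Type*} [NormedAddCommGroup P] [NormedSpace ℝ P]
    [NormedAddCommGroup F] [NormedSpace ℝ F] {O : Set (ℝ × P)} (hO : IsOpen O) {H : ℝ × P → F}
    (hH : ContDiffOn ℝ 1 H O) {p : P} (hp : ∀ τ ∈ Icc (0 : ℝ) 1, (τ, p) ∈ O) :
    HasFDerivAt (fun q => ∫ τ in (0 : ℝ)..1, H (τ, q))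
      (∫ τ in (0 : ℝ)..1, (fderiv ℝ H (τ, p)).comp (ContinuousLinearMap.inr ℝ ℝ P)) p := by
  have hD : ContinuousOn (fun z => (fderiv ℝ H z).comp (ContinuousLinearMap.inr ℝ ℝ P)) O :=
    (hH.continuousOn_fderiv_of_isOpen hO le_rfl).clm_comp continuousOn_const
  have hcurve : ∀ q : P, ContinuousOn (fun τ : ℝ => (τ, q)) (Icc 0 1) := fun q => by fun_prop
  obtain ⟨C, hC⟩ := (isCompact_Icc (a := (0 : ℝ)) (b := 1)).exists_bound_of_continuousOn
    (hD.comp (hcurve p) (fun τ hτ => hp τ hτ))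
  have hO' := hD.norm.isOpen_inter_preimage hO (isOpen_Iio (a := C + 1))
  have hs := (isOpen_setOf_segment_subset hO').mem_nhds (x := p) (fun τ hτ =>
    ⟨hp τ hτ, (hC τ hτ).trans_lt (lt_add_one C)⟩)
  have hsub : ∀ τ : ℝ, τ ∈ Ι (0 : ℝ) 1 → τ ∈ Icc (0 : ℝ) 1 := fun τ hτ => uIoc_zero_one_subset hτ
  refine intervalIntegral.hasFDerivAt_integral_of_dominated_of_fderiv_le
    (F := fun q τ => H (τ, q)) (bound := fun _ => C + 1)
    (F' := fun q τ => (fderiv ℝ H (τ, q)).comp (ContinuousLinearMap.inr ℝ ℝ P))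
    hs ?_ ?_ ?_ ?_ intervalIntegrable_const ?_
  · filter_upwards [hs] with q hq
    exact (hH.continuousOn.comp (hcurve q) fun τ hτ => (hq τ hτ).1).aestronglyMeasurable_uIoc
  · apply ContinuousOn.intervalIntegrable
    rw [uIcc_of_le zero_le_one]
    exact hH.continuousOn.comp (hcurve p) fun τ hτ => hp τ hτ
  · exact (hD.comp (hcurve p) fun τ hτ => hp τ hτ).aestronglyMeasurable_uIoc
  · exact ae_of_all _ fun τ hτ q hq => (hq τ (hsub τ hτ)).2.le
  · refine ae_of_all _ fun τ hτ q hq => ?_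
    have h1 : HasFDerivAt H (fderiv ℝ H (τ, q)) (τ, q) :=
      ((hH.contDiffAt (hO.mem_nhds (hq τ (hsub τ hτ)).1)).differentiableAt one_ne_zero).hasFDerivAt
    exact h1.comp q (hasFDerivAt_prodMk_right τ q)

/-- The target space is quantified inside the induction because the derivative is an integral of the
same kind with values in `P →L[ℝ] F`. -/
theorem contDiffOn_integral_nat {P : Type} [NormedAddCommGroup P] [NormedSpace ℝ P]
    {O : Set (ℝ × P)} (hO : IsOpen O) (n : ℕ) :
    ∀ (F : Type) [NormedAddCommGroup F] [NormedSpace ℝ F] (H : ℝ × P → F), ContDiffOn ℝ ∞ H O →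
      ContDiffOn ℝ n (fun q => ∫ τ in (0 : ℝ)..1, H (τ, q))
        {p : P | ∀ τ ∈ Icc (0 : ℝ) 1, (τ, p) ∈ O} := by
  induction n with
  | zero =>
    intro F _ _ H hH
    exact contDiffOn_zero.2 fun p hp => (hasFDerivAt_integral_of_contDiffOn hO
      (hH.of_le (by simp)) hp).continuousAt.continuousWithinAt
  | succ n ih =>
    intro F _ _ H hH
    have hd := fun p hp => hasFDerivAt_integral_of_contDiffOn hO (p := p) (hH.of_le (by simp)) hp
    rw [Nat.cast_add, Nat.cast_one,
      contDiffOn_succ_iff_fderiv_of_isOpen (isOpen_setOf_segment_subset hO)]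
    refine ⟨fun p hp => (hd p hp).differentiableAt.differentiableWithinAt, by simp, ?_⟩
    refine (ih (P →L[ℝ] F)
      (fun z => (fderiv ℝ H z).comp (ContinuousLinearMap.inr ℝ ℝ P)) ?_).congr
      fun p hp => (hd p hp).fderiv
    exact (hH.fderiv_of_isOpen hO (by simp)).clm_comp contDiffOn_const

/-- An integral of a smooth function over a fixed interval depends smoothly on parameters. -/
theorem contDiffOn_integral {P F : Type} [NormedAddCommGroup P] [NormedSpace ℝ P]
    [NormedAddCommGroup F] [NormedSpace ℝ F]
    {O : Set (ℝ × P)} (hO : IsOpen O) {H : ℝ × P → F} (hH : ContDiffOn ℝ ∞ H O) :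
    ContDiffOn ℝ ∞ (fun q => ∫ τ in (0 : ℝ)..1, H (τ, q))
      {p : P | ∀ τ ∈ Icc (0 : ℝ) 1, (τ, p) ∈ O} :=
  contDiffOn_infty.2 fun n => contDiffOn_integral_nat hO n F H hH

/-- A smooth function has a smooth primitive in its first variable; if its derivative in the
second variable is the derivative of `β` in the first, then the derivative of the primitive in
the second variable is the increment of `β`. -/
theorem exists_primitive_first {E F : Type} [NormedAddCommGroup E] [NormedSpace ℝ E]
    [NormedAddCommGroup F] [NormedSpace ℝ F] [CompleteSpace F] {J : Set ℝ} (hJ : IsOpen J)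
    (hJc : J.OrdConnected) (h0 : (0 : ℝ) ∈ J) {B : Set E} (hB : IsOpen B) {K : ℝ × E → F}
    (hK : ContDiffOn ℝ ∞ K (J ×ˢ B)) :
    ∃ χ : ℝ × E → F, ContDiffOn ℝ ∞ χ (J ×ˢ B) ∧
      (∀ t ∈ J, ∀ a ∈ B, HasDerivAt (fun s => χ (s, a)) (K (t, a)) t) ∧
      ∀ β : ℝ × E → E →L[ℝ] F,
        (∀ t ∈ J, ∀ a ∈ B, HasDerivAt (fun s => β (s, a))
          ((fderiv ℝ K (t, a)).comp (ContinuousLinearMap.inr ℝ ℝ E)) t) →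
        ∀ t ∈ J, ∀ a ∈ B, HasFDerivAt (fun b => χ (t, b)) (β (t, a) - β (0, a)) a := by
  have hseg : ∀ t ∈ J, ∀ τ ∈ Icc (0 : ℝ) 1, τ * t ∈ J := fun t ht τ hτ => by
    have : τ * t ∈ uIcc 0 t := by
      rcases le_total 0 t with h | h
      · rw [uIcc_of_le h]
        exact ⟨mul_nonneg hτ.1 h, mul_le_of_le_one_left h hτ.2⟩
      · rw [uIcc_of_ge h]
        exact ⟨by nlinarith [hτ.2], mul_nonpos_of_nonneg_of_nonpos hτ.1 h⟩
    exact hJc.uIcc_subset h0 ht this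
  set s : ℝ × ℝ × E → ℝ × E := fun z => (z.1 * z.2.1, z.2.2) with hs
  have hsc : ContDiff ℝ ∞ s := by fun_prop
  have hJB := hJ.prod hB
  set O := s ⁻¹' (J ×ˢ B)
  have hO : IsOpen O := hJB.preimage hsc.continuous
  have hKs : ContDiffOn ℝ ∞ (fun z => K (s z)) O := hK.comp hsc.contDiffOn fun z hz => hz
  have hmem : ∀ t ∈ J, ∀ a ∈ B, ∀ τ ∈ Icc (0 : ℝ) 1, (τ, (t, a)) ∈ O := fun t ht a ha τ hτ =>
    ⟨hseg t ht τ hτ, ha⟩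
  -- Rescaling the integral from 0 to t to the fixed interval [0, 1] makes joint smoothness in (t,
  -- a) a case of `contDiffOn_integral`.
  refine ⟨fun z => z.1 • ∫ τ in (0 : ℝ)..1, K (τ * z.1, z.2), ?_, ?_, ?_⟩
  · refine contDiffOn_fst.smul ?_
    exact (contDiffOn_integral hO hKs).mono fun z hz => hmem z.1 hz.1 z.2 hz.2
  · intro t ht a ha
    have hc : ContinuousOn (fun σ => K (σ, a)) J :=
      hK.continuousOn.comp (by fun_prop) fun σ hσ => ⟨hσ, ha⟩
    have heq : (fun s : ℝ => s • ∫ τ in (0 : ℝ)..1, K (τ * s, a)) =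
        fun s : ℝ => ∫ σ in (0 : ℝ)..s, K (σ, a) := by
      ext s
      rw [intervalIntegral.smul_integral_comp_mul_right (fun σ => K (σ, a))]
      simp
    change HasDerivAt (fun s : ℝ => s • ∫ τ in (0 : ℝ)..1, K (τ * s, a)) _ _
    rw [heq]
    refine intervalIntegral.integral_hasDerivAt_right
      (hc.mono (hJc.uIcc_subset h0 ht)).intervalIntegrable ?_ (hc.continuousAt (hJ.mem_nhds ht))
    exact hc.stronglyMeasurableAtFilter hJ t ht
  · intro β hβ t ht a ha
    have h1 : ContDiffOn ℝ 1 (fun w : ℝ × E => K (w.1 * t, w.2))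
        ((fun w : ℝ × E => (w.1 * t, w.2)) ⁻¹' (J ×ˢ B)) :=
      (hK.of_le (by simp)).comp (by fun_prop) fun w hw => hw
    have h2 := (hasFDerivAt_integral_of_contDiffOn (hJB.preimage (by fun_prop)) h1 (p := a)
      (fun τ hτ => ⟨hseg t ht τ hτ, ha⟩)).const_smul t
    have hDK : ContinuousOn (fun z => (fderiv ℝ K z).comp (ContinuousLinearMap.inr ℝ ℝ E))
        (J ×ˢ B) := (hK.continuousOn_fderiv_of_isOpen hJB (by simp)).clm_comp continuousOn_const
    have h3 : ∫ σ in (0 : ℝ)..t, (fderiv ℝ K (σ, a)).comp (ContinuousLinearMap.inr ℝ ℝ E) =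
        β (t, a) - β (0, a) := by
      refine intervalIntegral.integral_eq_sub_of_hasDerivAt
        (fun σ hσ => hβ σ (hJc.uIcc_subset h0 ht hσ) a ha) ?_
      refine ContinuousOn.intervalIntegrable (hDK.comp (by fun_prop) fun σ hσ => ?_)
      exact ⟨hJc.uIcc_subset h0 ht hσ, ha⟩
    change HasFDerivAt (t • fun q => ∫ τ in (0 : ℝ)..1, K (τ * t, q)) _ a
    rw [← h3]
    have h4 := intervalIntegral.smul_integral_comp_mul_right (a := 0) (b := 1)
      (fun σ => (fderiv ℝ K (σ, a)).comp (ContinuousLinearMap.inr ℝ ℝ E)) t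
    rw [zero_mul, one_mul] at h4
    rw [← h4]
    convert h2 using 1
    congr 1
    refine intervalIntegral.integral_congr fun τ hτ => ?_
    rw [uIcc_of_le zero_le_one] at hτ
    have hk : HasFDerivAt K (fderiv ℝ K (τ * t, a)) (τ * t, a) :=
      ((hK.contDiffAt (hJB.mem_nhds ⟨hseg t ht τ hτ, ha⟩)).differentiableAt (by simp)).hasFDerivAt
    have hl : HasFDerivAt (fun w : ℝ × E => (w.1 * t, w.2))
        (((ContinuousLinearMap.fst ℝ ℝ E).smulRight t).prod (ContinuousLinearMap.snd ℝ ℝ E))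
        (τ, a) := by
      have := ((ContinuousLinearMap.fst ℝ ℝ E).smulRight t).hasFDerivAt (x := (τ, a))
      exact this.prodMk hasFDerivAt_snd
    have := (hk.comp (τ, a) hl).fderiv
    simp only [Function.comp_def] at this
    simp only [this]
    ext v
    simp

/-- The exterior derivative of a 1-form, as an alternating function. -/
def extD {E : Type*} [NormedAddCommGroup E] [NormedSpace ℝ E] (α : E → E →L[ℝ] ℝ) (x h k : E) :
    ℝ := fderiv ℝ α x h k - fderiv ℝ α x k h

theorem extD_congr {E : Type*} [NormedAddCommGroup E] [NormedSpace ℝ E] {α β : E → E →L[ℝ] ℝ}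
    {x : E} (h : α =ᶠ[𝓝 x] β) : extD α x = extD β x := by
  ext v w; simp only [extD, h.fderiv_eq]

theorem extD_fderiv {E : Type*} [NormedAddCommGroup E] [NormedSpace ℝ E] {F : E → ℝ}
    {x : E} (hF : ContDiffAt ℝ ∞ F x) (h k : E) : extD (fderiv ℝ F) x h k = 0 := by
  have := (hF.isSymmSndFDerivAt (by simp; norm_cast)).eq h k
  simp [extD, this]

theorem extD_add {E : Type*} [NormedAddCommGroup E] [NormedSpace ℝ E] {α β : E → E →L[ℝ] ℝ}
    {x : E} (hα : DifferentiableAt ℝ α x) (hβ : DifferentiableAt ℝ β x) (h k : E) :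
    extD (fun y => α y + β y) x h k = extD α x h k + extD β x h k := by
  simp only [extD, fderiv_fun_add hα hβ, add_apply]; ring

/-- This is d(dF + φ dψ) = dφ ∧ dψ: the second derivatives of F and ψ cancel by symmetry. -/
theorem extD_clebsch {E : Type*} [NormedAddCommGroup E] [NormedSpace ℝ E] {α : E → E →L[ℝ] ℝ}
    {F φ ψ : E → ℝ} {x : E} (hF : ContDiffAt ℝ ∞ F x) (hφ : ContDiffAt ℝ ∞ φ x)
    (hψ : ContDiffAt ℝ ∞ ψ x)
    (h : α =ᶠ[𝓝 x] fun y => fderiv ℝ F y + φ y • fderiv ℝ ψ y) (v w : E) :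
    extD α x v w =
      fderiv ℝ φ x v * fderiv ℝ ψ x w - fderiv ℝ φ x w * fderiv ℝ ψ x v := by
  have h1 : (∞ : WithTop ℕ∞) ≠ 0 := by simp
  have hF' : DifferentiableAt ℝ (fderiv ℝ F) x :=
    (hF.fderiv_right (m := ∞) (by simp)).differentiableAt h1
  have hψ' : DifferentiableAt ℝ (fderiv ℝ ψ) x :=
    (hψ.fderiv_right (m := ∞) (by simp)).differentiableAt h1
  have hφ' := hφ.differentiableAt h1
  rw [extD_congr h, extD_add (β := fun y => φ y • fderiv ℝ ψ y) hF' (hφ'.smul hψ'), extD_fderiv hF]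
  have := (hψ.isSymmSndFDerivAt (by simp; norm_cast)).eq v w
  simp only [extD, fderiv_fun_smul hφ' hψ', add_apply,
    smul_apply, ContinuousLinearMap.smulRight_apply, this, smul_eq_mul]
  ring

/-- The exterior derivative commutes with pullback, since the terms with the second derivative of e
are symmetric and cancel. -/
theorem extD_pullback {E E' : Type*} [NormedAddCommGroup E] [NormedSpace ℝ E]
    [NormedAddCommGroup E'] [NormedSpace ℝ E'] {α : E → E →L[ℝ] ℝ} {e : E' → E} {z : E'}
    (he : ContDiffAt ℝ ∞ e z) (hα : DifferentiableAt ℝ α (e z)) (v w : E') :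
    extD (fun y => (α (e y)).comp (fderiv ℝ e y)) z v w =
      extD α (e z) (fderiv ℝ e z v) (fderiv ℝ e z w) := by
  have h1 : (∞ : WithTop ℕ∞) ≠ 0 := by simp
  have he' : DifferentiableAt ℝ (fderiv ℝ e) z :=
    (he.fderiv_right (m := ∞) (by simp)).differentiableAt h1
  have hc := hα.hasFDerivAt.comp z (he.differentiableAt h1).hasFDerivAt
  have := (hc.clm_comp he'.hasFDerivAt).fderiv
  simp only [Function.comp_def] at this
  have hs := (he.isSymmSndFDerivAt (by simp; norm_cast)).eq v w
  simp [extD, this, hs]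

end Calculus

/-! ### Smooth local flows and flow boxes. -/

section Flow

/-- The bilinear pairing applying a family of operators to a family of vectors. -/
def ContinuousMap.applyL (K E F : Type*) [TopologicalSpace K] [CompactSpace K]
    [NormedAddCommGroup E] [NormedSpace ℝ E] [NormedAddCommGroup F] [NormedSpace ℝ F] :
    C(K, E →L[ℝ] F) →L[ℝ] C(K, E) →L[ℝ] C(K, F) :=
  LinearMap.mkContinuous₂
    (LinearMap.mk₂ ℝ (fun (A : C(K, E →L[ℝ] F)) (η : C(K, E)) =>
        (⟨fun k => A k (η k), A.continuous.clm_apply η.continuous⟩ : C(K, F)))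
      (fun A A' η => by ext; simp) (fun c A η => by ext; simp) (fun A η η' => by ext; simp)
      (fun c A η => by ext; simp)) 1
    (fun A η => by
      refine (ContinuousMap.norm_le _ (by positivity)).2 fun k => ?_
      rw [one_mul]
      exact (ContinuousLinearMap.le_opNorm _ _).trans (mul_le_mul (A.norm_coe_le_norm k)
        (η.norm_coe_le_norm k) (by positivity) (by positivity)))

/-- The mean value inequality is applied pointwise in k. What must be uniform in k is the closeness
of v' near γ k to v' (γ k), and continuity of η ↦ v' ∘ η in the sup norm supplies it. -/
theorem hasFDerivAt_postcomp {K E F : Type*} [TopologicalSpace K] [CompactSpace K]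
    [NormedAddCommGroup E] [NormedSpace ℝ E] [NormedAddCommGroup F] [NormedSpace ℝ F]
    (v : C(E, F)) (v' : C(E, E →L[ℝ] F)) (hv : ∀ x, HasFDerivAt v (v' x) x) (γ : C(K, E)) :
    HasFDerivAt (fun η : C(K, E) => v.comp η) (ContinuousMap.applyL K E F (v'.comp γ)) γ := by
  refine HasFDerivAt.of_isLittleO (Asymptotics.isLittleO_iff.2 fun c hc => ?_)
  obtain ⟨δ, hδ, h⟩ := Metric.eventually_nhds_iff_ball.1
    ((ContinuousMap.continuous_postcomp (X := K) v').continuousAt.eventually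
      (ball_mem_nhds (v'.comp γ) hc))
  filter_upwards [ball_mem_nhds γ hδ] with η hη
  refine (ContinuousMap.norm_le _ (by positivity)).2 fun k => ?_
  have hk : η k ∈ ball (γ k) δ := (ContinuousMap.dist_apply_le_dist k).trans_lt hη
  have := (convex_ball (γ k) δ).norm_image_sub_le_of_norm_hasFDerivWithin_le' (f := v) (f' := v')
    (φ := v' (γ k)) (C := c) (fun x _ => (hv x).hasFDerivWithinAt) (fun x hx => ?_)
    (mem_ball_self hδ) hk
  · refine this.trans (mul_le_mul_of_nonneg_left ?_ hc.le)
    exact (η - γ).norm_coe_le_norm k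
  -- The translate of γ by the constant x − γ k stays within δ of γ and takes the value x at k, so
  -- the sup-norm estimate can be read off at x.
  · have h2 := h (γ + ContinuousMap.const K (x - γ k)) (by
      rw [mem_ball, dist_eq_norm, add_sub_cancel_left]
      refine (ContinuousMap.norm_lt_iff _ hδ).2 fun _ => ?_
      rw [ContinuousMap.const_apply, ← dist_eq_norm]; exact hx)
    have h3 := (ContinuousMap.dist_apply_le_dist (f := v'.comp (γ + ContinuousMap.const K (x - γ k)))
      (g := v'.comp γ) k).trans (le_of_lt h2)
    rw [dist_eq_norm] at h3
    simpa using h3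

theorem contDiff_postcomp_nat {K E : Type} [TopologicalSpace K] [CompactSpace K]
    [NormedAddCommGroup E] [NormedSpace ℝ E] (n : ℕ) :
    ∀ (F : Type) [NormedAddCommGroup F] [NormedSpace ℝ F] (v : C(E, F)), ContDiff ℝ ∞ v →
      ContDiff ℝ n (fun η : C(K, E) => v.comp η) := by
  induction n with
  | zero =>
    intro F _ _ v _
    exact contDiff_zero.2 (ContinuousMap.continuous_postcomp v)
  | succ n ih =>
    intro F _ _ v hv
    rw [Nat.cast_add, Nat.cast_one, contDiff_succ_iff_hasFDerivAt]
    let v' : C(E, E →L[ℝ] F) := ⟨fderiv ℝ v, hv.continuous_fderiv (by simp)⟩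
    refine ⟨fun η => ContinuousMap.applyL K E F (v'.comp η), ?_, fun η =>
      hasFDerivAt_postcomp v v' (fun x => (hv.differentiable (by simp) x).hasFDerivAt) η⟩
    exact (ContinuousMap.applyL K E F).contDiff.comp
      (ih _ v' (hv.fderiv_right (m := ∞) (by simp)))

/-- Composition with a smooth function is a smooth operator between spaces of continuous
functions on a compact space. -/
theorem contDiff_postcomp {K E F : Type} [TopologicalSpace K] [CompactSpace K]
    [NormedAddCommGroup E] [NormedSpace ℝ E] [NormedAddCommGroup F] [NormedSpace ℝ F]
    (v : C(E, F)) (hv : ContDiff ℝ ∞ v) : ContDiff ℝ ∞ (fun η : C(K, E) => v.comp η) :=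
  contDiff_infty.2 fun n => contDiff_postcomp_nat n F v hv

open unitInterval in
/-- The operator taking a continuous function on `[0, 1]` to its primitive. -/
def primitiveL (E : Type*) [NormedAddCommGroup E] [NormedSpace ℝ E] : C(I, E) →L[ℝ] C(I, E) :=
  LinearMap.mkContinuous
    { toFun := fun η => ⟨fun t => ∫ τ in (0 : ℝ)..t, IccExtend zero_le_one η τ,
        (intervalIntegral.continuous_primitive (fun a b =>
          (η.continuous.Icc_extend' (h := zero_le_one)).intervalIntegrable a b) 0).comp
            continuous_subtype_val⟩
      map_add' := fun η η' => by
        ext t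
        exact intervalIntegral.integral_add
          ((η.continuous.Icc_extend' (h := zero_le_one)).intervalIntegrable _ _)
          ((η'.continuous.Icc_extend' (h := zero_le_one)).intervalIntegrable _ _)
      map_smul' := fun c η => by
        ext t
        exact intervalIntegral.integral_smul c _ } 1
    (fun η => by
      refine (ContinuousMap.norm_le _ (by positivity)).2 fun t => ?_
      have := intervalIntegral.norm_integral_le_of_norm_le_const (a := 0) (b := (t : ℝ))
        (f := IccExtend zero_le_one η) (C := ‖η‖) fun τ _ => η.norm_coe_le_norm _
      refine this.trans ?_
      rw [sub_zero, abs_of_nonneg t.2.1, one_mul]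
      exact mul_le_of_le_one_right (norm_nonneg _) t.2.2)

open unitInterval in
theorem primitiveL_apply {E : Type*} [NormedAddCommGroup E] [NormedSpace ℝ E] (η : C(I, E))
    (t : I) : primitiveL E η t = ∫ τ in (0 : ℝ)..t, IccExtend zero_le_one η τ := rfl

open unitInterval in
-- Substitution r ↦ t r in the integral; in the flow construction it shows that slowing down a
-- solution yields the solution with smaller time parameter.
theorem primitiveL_comp_mul {E : Type*} [NormedAddCommGroup E] [NormedSpace ℝ E] (η : C(I, E))
    (t τ : I) : (t : ℝ) • primitiveL E (η.comp ⟨fun r => t * r, by fun_prop⟩) τ =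
      primitiveL E η (t * τ) := by
  have h := intervalIntegral.smul_integral_comp_mul_left (a := 0) (b := (τ : ℝ))
    (IccExtend zero_le_one η) (t : ℝ)
  rw [mul_zero] at h
  rw [primitiveL_apply, primitiveL_apply, Icc.coe_mul, ← h]
  congr 1
  refine intervalIntegral.integral_congr fun r hr => ?_
  rw [uIcc_of_le τ.2.1] at hr
  have hr' : r ∈ I := ⟨hr.1, hr.2.trans τ.2.2⟩
  have hr2 : (t : ℝ) * r ∈ I := (t * ⟨r, hr'⟩ : I).2
  simp only [IccExtend_of_mem _ _ hr', IccExtend_of_mem _ _ hr2]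
  rfl

open unitInterval in
/-- A smooth vector field has a smooth local flow. -/
theorem exists_contDiffOn_flow {E : Type} [NormedAddCommGroup E] [NormedSpace ℝ E]
    [CompleteSpace E] {v : E → E} (hv : ContDiff ℝ ∞ v) (a : E) :
    ∃ (Φ : ℝ × E → E) (ε : ℝ), 0 < ε ∧ ContDiffOn ℝ ∞ Φ (Ioo (-ε) ε ×ˢ ball a ε) ∧
      (∀ x ∈ ball a ε, Φ (0, x) = x) ∧
      ∀ s ∈ Ioo (-ε) ε, ∀ x ∈ ball a ε, HasDerivAt (fun r => Φ (r, x)) (v (Φ (s, x))) s := by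
  set vc : C(E, E) := ⟨v, hv.continuous⟩ with hvc
  obtain ⟨c, hc⟩ : ∃ c : E →L[ℝ] C(I, E), ∀ x t, c x t = x :=
    ⟨ContinuousLinearMap.const ℝ I, fun _ _ => rfl⟩
  set N : C(I, E) → C(I, E) := fun η => primitiveL E (vc.comp η) with hN
  have hNs : ContDiff ℝ ∞ N := (primitiveL E).contDiff.comp (contDiff_postcomp vc hv)
  -- The second component vanishes when η(t) = x + s ∫₀ᵗ v(η), that is, when η is the integral curve
  -- from x run at speed s over [0, 1]. At s = 0 the derivative is block triangular with identity
  -- diagonal, so the inverse function theorem yields η as a smooth function Γ of (s, x).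
  set G : (ℝ × E) × C(I, E) → (ℝ × E) × C(I, E) :=
    fun z => (z.1, z.2 - c z.1.2 - z.1.1 • N z.2) with hG
  have hGs : ContDiff ℝ ∞ G := by
    refine contDiff_fst.prodMk ((contDiff_snd.sub (c.contDiff.comp contDiff_fst.snd)).sub ?_)
    exact contDiff_fst.fst.smul (hNs.comp contDiff_snd)
  set T : ℝ × E →L[ℝ] C(I, E) :=
    -(c.comp (ContinuousLinearMap.snd ℝ ℝ E)) -
      (ContinuousLinearMap.fst ℝ ℝ E).smulRight (N (c a)) with hT
  have hG' : HasFDerivAt G (((ContinuousLinearEquiv.refl ℝ (ℝ × E)).skewProd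
      (ContinuousLinearEquiv.refl ℝ C(I, E)) T : _ ≃L[ℝ] _) :
        (ℝ × E) × C(I, E) →L[ℝ] (ℝ × E) × C(I, E)) ((0, a), c a) := by
    have h1 : HasFDerivAt N (fderiv ℝ N (c a)) (c a) :=
      (hNs.differentiable (by simp) _).hasFDerivAt
    have h2 : HasFDerivAt (fun z : (ℝ × E) × C(I, E) => N z.2)
        ((fderiv ℝ N (c a)).comp (ContinuousLinearMap.snd ℝ (ℝ × E) C(I, E))) ((0, a), c a) :=
      HasFDerivAt.comp (g := N) ((0, a), c a) h1 hasFDerivAt_snd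
    have h3 : HasFDerivAt (fun z : (ℝ × E) × C(I, E) => z.1.1)
        ((ContinuousLinearMap.fst ℝ ℝ E).comp (ContinuousLinearMap.fst ℝ (ℝ × E) C(I, E)))
        ((0, a), c a) := ((ContinuousLinearMap.fst ℝ ℝ E).comp
          (ContinuousLinearMap.fst ℝ (ℝ × E) C(I, E))).hasFDerivAt
    have h4 : HasFDerivAt (fun z : (ℝ × E) × C(I, E) => z.2 - c z.1.2)
        (ContinuousLinearMap.snd ℝ (ℝ × E) C(I, E) - c.comp ((ContinuousLinearMap.snd ℝ ℝ E).comp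
          (ContinuousLinearMap.fst ℝ (ℝ × E) C(I, E)))) ((0, a), c a) :=
      ContinuousLinearMap.hasFDerivAt (ContinuousLinearMap.snd ℝ (ℝ × E) C(I, E) -
        c.comp ((ContinuousLinearMap.snd ℝ ℝ E).comp (ContinuousLinearMap.fst ℝ (ℝ × E) C(I, E))))
    have h5 := (hasFDerivAt_fst (p := ((0, a), c a)) (E := ℝ × E) (F := C(I, E)) (𝕜 := ℝ)).prodMk
      (h4.sub (h3.smul h2))
    refine h5.congr_fderiv ?_
    ext z <;> simp [hT]
  obtain ⟨e, he, hz, -, hes⟩ := exists_openPartialHomeomorph_contDiffOn isOpen_univ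
    hGs.contDiffOn (mem_univ _) _ hG'
  have hGz : G ((0, a), c a) = ((0, a), 0) := by simp [hG]
  obtain ⟨δ, hδ, hball⟩ := Metric.isOpen_iff.1 e.open_source _ hz
  have htz : ((0, a), 0) ∈ e.target := by
    rw [← hGz, ← he]; exact e.map_source hz
  set Γ : ℝ × E → C(I, E) := fun p => (e.symm (p, 0)).2 with hΓ
  have hΓz : Γ (0, a) = c a := by
    have : e.symm ((0, a), 0) = ((0, a), c a) := by
      rw [← hGz, ← he]; exact e.left_inv hz
    simp [hΓ, this]
  set W₀ : Set (ℝ × E) := (fun p => (p, (0 : C(I, E)))) ⁻¹' e.target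
  have hW₀ : IsOpen W₀ := e.open_target.preimage (by fun_prop)
  have hΓs : ContDiffOn ℝ ∞ Γ W₀ :=
    contDiff_snd.comp_contDiffOn (hes.comp (by fun_prop) fun p hp => hp)
  have hW := (hΓs.continuousOn.isOpen_inter_preimage hW₀ (isOpen_ball (x := c a) (ε := δ))).inter
    (isOpen_ball (x := ((0 : ℝ), a)) (ε := δ))
  obtain ⟨ε, hε, hεW⟩ := Metric.isOpen_iff.1 hW (0, a)
    ⟨⟨htz, by simp [hΓz, hδ]⟩, mem_ball_self hδ⟩
  have hbox : ∀ s ∈ Ioo (-ε) ε, ∀ x ∈ ball a ε, (s, x) ∈ ball ((0 : ℝ), a) ε := by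
    intro s hs x hx
    rw [← ball_prod_same]
    exact ⟨by rw [Real.ball_eq_Ioo]; simpa using hs, hx⟩
  have hfix : ∀ p ∈ W₀, e.symm (p, 0) = (p, Γ p) ∧ Γ p = c p.2 + p.1 • N (Γ p) := by
    intro p hp
    have h1 : G (e.symm (p, 0)) = (p, 0) := by rw [← he]; exact e.right_inv hp
    have h2 : (e.symm (p, 0)).1 = p := congrArg Prod.fst h1
    have h3 := congrArg Prod.snd h1
    simp only [hG, h2] at h3
    refine ⟨Prod.ext h2 rfl, ?_⟩
    rw [← sub_eq_zero, ← h3, hΓ]; simp only; abel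
  have huniq : ∀ p ∈ W₀, p ∈ ball ((0 : ℝ), a) δ → ∀ γ ∈ ball (c a) δ,
      γ = c p.2 + p.1 • N γ → γ = Γ p := by
    intro p hp hpδ γ hγ h
    have h1 : (p, γ) ∈ e.source := hball (by rw [← ball_prod_same]; exact ⟨hpδ, hγ⟩)
    have h2 : e (p, γ) = (p, 0) := by
      rw [he]; simp only [hG, Prod.mk.injEq, true_and]
      nth_rewrite 1 [h]; abel
    have h3 := e.left_inv h1
    rw [h2, (hfix p hp).1] at h3
    exact (congrArg Prod.snd h3).symm
  -- By local uniqueness of fixed points, the curve for (s, x) slowed down by t is the curve for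
  -- (ts, x). This turns the family of fixed-point equations into the integral equation for s ↦ Γ(s,
  -- x)(1).
  have hscale : ∀ s ∈ Ioo (-ε) ε, ∀ x ∈ ball a ε, ∀ t : I, Γ (t * s, x) 1 = Γ (s, x) t := by
    intro s hs x hx t
    have hts : (t : ℝ) * s ∈ Ioo (-ε) ε := by
      refine abs_lt.1 ?_
      rw [abs_mul, abs_of_nonneg t.2.1]
      exact (mul_le_of_le_one_left (abs_nonneg s) t.2.2).trans_lt (abs_lt.2 hs)
    obtain ⟨⟨hp, hpΓ⟩, -⟩ := hεW (hbox s hs x hx)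
    obtain ⟨⟨hp', -⟩, hpδ'⟩ := hεW (hbox _ hts x hx)
    have := huniq (t * s, x) hp' hpδ' ((Γ (s, x)).comp ⟨fun r => t * r, by fun_prop⟩) ?_ ?_
    · rw [← this]; simp
    · refine (ContinuousMap.dist_lt_iff hδ).2 fun r => ?_
      have := (ContinuousMap.dist_apply_le_dist (f := Γ (s, x)) (g := c a) (t * r)).trans_lt hpΓ
      rw [hc] at this ⊢
      exact this
    · ext r
      have h1 := DFunLike.congr_fun (hfix _ hp).2 (t * r)
      have h2 := primitiveL_comp_mul (vc.comp (Γ (s, x))) t r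
      change Γ (s, x) (t * r) = c x r +
        ((t : ℝ) * s) • primitiveL E ((vc.comp (Γ (s, x))).comp ⟨fun r => t * r, by fun_prop⟩) r
      rw [mul_comm (t : ℝ), mul_smul, h2, h1, hc]
      simp [hc, hN]
  refine ⟨fun p => Γ p 1, ε, hε, ?_, ?_, ?_⟩
  · refine (ContinuousMap.evalCLM ℝ (1 : I)).contDiff.comp_contDiffOn (hΓs.mono ?_)
    rintro ⟨s, x⟩ ⟨hs, hx⟩
    exact (hεW (hbox s hs x hx)).1.1
  · intro x hx
    have h0 : (0 : ℝ) ∈ Ioo (-ε) ε := by simpa using hε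
    have := DFunLike.congr_fun (hfix _ (hεW (hbox 0 h0 x hx)).1.1).2 1
    simpa [hc] using this
  · intro s hs x hx
    have hcont : ContinuousOn (fun r => Γ (r, x) 1) (Ioo (-ε) ε) := by
      refine (ContinuousMap.evalCLM ℝ (1 : I)).continuous.comp_continuousOn
        (hΓs.continuousOn.comp (by fun_prop) ?_)
      exact fun r hr => (hεW (hbox r hr x hx)).1.1
    have hvcont : ContinuousOn (fun r => v (Γ (r, x) 1)) (Ioo (-ε) ε) :=
      hv.continuous.comp_continuousOn hcont
    have heq : ∀ r ∈ Ioo (-ε) ε, Γ (r, x) 1 = x + ∫ w in (0 : ℝ)..r, v (Γ (w, x) 1) := by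
      intro r hr
      have h1 := DFunLike.congr_fun (hfix _ (hεW (hbox r hr x hx)).1.1).2 1
      rw [h1]
      have h2 := intervalIntegral.smul_integral_comp_mul_right (a := 0) (b := 1)
        (fun w => v (Γ (w, x) 1)) r
      rw [zero_mul, one_mul] at h2
      rw [← h2]
      simp only [ContinuousMap.add_apply, ContinuousMap.smul_apply, hN, primitiveL_apply, hc]
      congr 2
      refine intervalIntegral.integral_congr fun w hw => ?_
      rw [Icc.coe_one, uIcc_of_le zero_le_one] at hw
      simp only [IccExtend_of_mem _ _ hw, ContinuousMap.comp_apply]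
      rw [← hscale r hr x hx ⟨w, hw⟩]
      rfl
    have h0 : (0 : ℝ) ∈ Ioo (-ε) ε := by simpa using hε
    have hd : HasDerivAt (fun r => x + ∫ w in (0 : ℝ)..r, v (Γ (w, x) 1)) (v (Γ (s, x) 1)) s := by
      refine (intervalIntegral.integral_hasDerivAt_right ?_ ?_ ?_).const_add x
      · exact (hvcont.mono (ordConnected_Ioo.uIcc_subset h0 hs)).intervalIntegrable
      · exact hvcont.stronglyMeasurableAtFilter isOpen_Ioo s hs
      · exact hvcont.continuousAt (isOpen_Ioo.mem_nhds hs)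
    exact hd.congr_of_eventuallyEq (eventually_of_mem (isOpen_Ioo.mem_nhds hs) heq)

/-- Smooth local coordinates which straighten a vector field around a point where it does not
vanish. -/
theorem exists_flowBox {E Y : Type} [NormedAddCommGroup E] [NormedSpace ℝ E]
    [FiniteDimensional ℝ E] [NormedAddCommGroup Y] [NormedSpace ℝ Y] {v : E → E}
    {B : Set E} (hB : IsOpen B) (hv : ContDiffOn ℝ ∞ v B) {a : E} (ha : a ∈ B)
    (L : (ℝ × Y) ≃L[ℝ] E) (hL : L (1, 0) = v a) :
    ∃ e : OpenPartialHomeomorph (ℝ × Y) E, (0, 0) ∈ e.source ∧ e (0, 0) = a ∧ e.target ⊆ B ∧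
      ContDiffOn ℝ ∞ e e.source ∧ ContDiffOn ℝ ∞ e.symm e.target ∧
      ∀ z ∈ e.source, fderiv ℝ e z (1, 0) = v (e z) := by
  have : CompleteSpace E := FiniteDimensional.complete ℝ E
  have : CompleteSpace (ℝ × Y) := by
    have := L.symm.toLinearEquiv.finiteDimensional
    exact FiniteDimensional.complete ℝ _
  obtain ⟨r, hr, hrB⟩ := Metric.isOpen_iff.1 hB a ha
  -- The bump function makes the field globally smooth, so that it has a flow; on the ball of radius
  -- r/4, to which the box is later confined, the field is unchanged.
  let b : ContDiffBump a := ⟨r / 4, r / 2, by positivity, by linarith⟩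
  have hw : ContDiff ℝ ∞ fun x => b x • v x := by
    rw [contDiff_iff_contDiffAt]
    intro x
    by_cases hx : x ∈ ball a r
    · exact b.contDiffAt.smul (hv.contDiffAt (hB.mem_nhds (hrB hx)))
    · have hx' : x ∈ (closedBall a (r / 2))ᶜ := fun h =>
        hx (closedBall_subset_ball (by linarith) h)
      refine (contDiffAt_const (c := (0 : E))).congr_of_eventuallyEq ?_
      filter_upwards [isClosed_closedBall.isOpen_compl.mem_nhds hx'] with y hy
      have : b y = 0 := b.zero_of_le_dist (by
        simp only [mem_compl_iff, mem_closedBall, not_le] at hy; exact hy.le)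
      rw [this, zero_smul]
  have hwv : ∀ x ∈ ball a (r / 4), b x • v x = v x := fun x hx => by
    rw [b.one_of_mem_closedBall (ball_subset_closedBall hx), one_smul]
  obtain ⟨Φ, ε, hε, hΦ, hΦ0, hΦd⟩ := exists_contDiffOn_flow hw a
  set ι : Y →L[ℝ] E := (L : (ℝ × Y) →L[ℝ] E).comp (ContinuousLinearMap.inr ℝ ℝ Y) with hι
  -- Points of the transversal a + ι(Y) are moved for time s along the flow. At the origin the
  -- derivative is L, whose value at (1, 0) is v a.
  set Ψ : ℝ × Y → E := fun z => Φ (z.1, a + ι z.2) with hΨ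
  set O₁ : Set (ℝ × Y) := (fun z : ℝ × Y => (z.1, a + ι z.2)) ⁻¹' (Ioo (-ε) ε ×ˢ ball a ε) with hO₁
  have hO₁o : IsOpen O₁ := (isOpen_Ioo.prod isOpen_ball).preimage (by fun_prop)
  have hΨ₁ : ContDiffOn ℝ ∞ Ψ O₁ := hΦ.comp (by fun_prop) fun z hz => hz
  set O := O₁ ∩ Ψ ⁻¹' ball a (r / 4) with hOdef
  have hO : IsOpen O := hΨ₁.continuousOn.isOpen_inter_preimage hO₁o isOpen_ball
  have h0ε : (0 : ℝ) ∈ Ioo (-ε) ε := by simpa using hε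
  have h0O₁ : (0, 0) ∈ O₁ := ⟨h0ε, by simp [hε]⟩
  have hΨ0 : Ψ (0, 0) = a := by
    simp only [hΨ, map_zero, add_zero]; exact hΦ0 a (mem_ball_self hε)
  have h0O : (0, 0) ∈ O := ⟨h0O₁, by simp [hΨ0, hr]⟩
  have hdiff : ∀ z ∈ O₁, HasFDerivAt Ψ (fderiv ℝ Ψ z) z := fun z hz =>
    ((hΨ₁.contDiffAt (hO₁o.mem_nhds hz)).differentiableAt (by simp)).hasFDerivAt
  have hflow : ∀ z ∈ O, fderiv ℝ Ψ z (1, 0) = v (Ψ z) := by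
    rintro ⟨s, y⟩ hz
    have h1 := hΦd s hz.1.1 _ hz.1.2
    have h2 : HasDerivAt (fun r : ℝ => (r, y)) ((1 : ℝ), (0 : Y)) s :=
      (hasDerivAt_id s).prodMk (hasDerivAt_const s y)
    have h3 := (hdiff _ hz.1).comp_hasDerivAt s h2
    rw [← hwv _ hz.2]
    exact h3.unique h1
  have hΨ' : HasFDerivAt Ψ (L : (ℝ × Y) →L[ℝ] E) (0, 0) := by
    have h := hdiff _ h0O₁
    refine h.congr_fderiv ?_
    have h1 := hflow _ h0O
    rw [hΨ0, ← hL] at h1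
    have h2 : (fderiv ℝ Ψ (0, 0)).comp (ContinuousLinearMap.inr ℝ ℝ Y) = ι := by
      have h3 := h.comp (0 : Y) (hasFDerivAt_prodMk_right (0 : ℝ) (0 : Y))
      have h4 : HasFDerivAt (fun y => a + ι y) ι (0 : Y) := ι.hasFDerivAt.const_add a
      refine h3.unique (h4.congr_of_eventuallyEq ?_)
      have : (fun y => a + ι y) ⁻¹' ball a ε ∈ 𝓝 (0 : Y) :=
        (isOpen_ball.preimage (by fun_prop)).mem_nhds (by simp [hε])
      filter_upwards [this] with y hy
      exact hΦ0 _ hy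
    ext z
    · simpa using h1
    · exact DFunLike.congr_fun h2 z
  obtain ⟨e, he, hz, hes, hsymm⟩ := exists_openPartialHomeomorph_contDiffOn hO
    (hΨ₁.mono inter_subset_left) h0O L hΨ'
  refine ⟨e, hz, by rw [he, hΨ0], ?_, ?_, hsymm, ?_⟩
  · rw [← e.image_source_eq_target, he]
    rintro _ ⟨z, hz, rfl⟩
    exact hrB (ball_subset_ball (by linarith) (hes hz).2)
  · rw [he]; exact hΨ₁.mono fun z hz => (hes hz).1
  · rw [he]; exact fun z hz => hflow z (hes hz)

end Flow

/-! ### The normal form of a 1-form whose exterior derivative is annihilated by the first coordinate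
direction. -/

section NormalForm

theorem exists_clebsch_normalForm {J : Set ℝ} (hJ : IsOpen J) (hJc : J.OrdConnected)
    (h0 : (0 : ℝ) ∈ J) {θ : ℝ × ℝ × ℝ → (ℝ × ℝ × ℝ) →L[ℝ] ℝ}
    (hθ : ContDiffOn ℝ ∞ θ (J ×ˢ J ×ˢ J))
    (hd : ∀ z ∈ J ×ˢ J ×ˢ J, ∀ w, extD θ z (1, 0) w = 0) :
    ∃ (f : ℝ × ℝ × ℝ → ℝ) (φ : ℝ × ℝ → ℝ), ContDiffOn ℝ ∞ f (J ×ˢ J ×ˢ J) ∧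
      ContDiffOn ℝ ∞ φ (J ×ˢ J) ∧
      ∀ z ∈ J ×ˢ J ×ˢ J, ∀ w, θ z w = fderiv ℝ f z w + φ z.2 * w.2.2 := by
  have hJJ := hJ.prod hJ
  have hQ := hJ.prod hJJ
  have htop : (∞ : WithTop ℕ∞) ≠ 0 := by simp
  set K : ℝ × ℝ × ℝ → ℝ := fun z => θ z (1, 0)
  have hK : ContDiffOn ℝ ∞ K (J ×ˢ J ×ˢ J) := hθ.clm_apply contDiffOn_const
  obtain ⟨χ, hχ, hχ1, hχ2⟩ := exists_primitive_first hJ hJc h0 hJJ hK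
  have hθ' : ∀ z ∈ J ×ˢ J ×ˢ J, HasFDerivAt θ (fderiv ℝ θ z) z := fun z hz =>
    ((hθ.contDiffAt (hQ.mem_nhds hz)).differentiableAt htop).hasFDerivAt
  set ι := ContinuousLinearMap.inr ℝ ℝ (ℝ × ℝ)
  -- The vanishing of dθ(∂₁, ·) says that the transversal part of θ has as derivative in the first
  -- variable the transversal differential of K = θ(∂₁). Hence θ − dχ has no first component and
  -- equals the transversal part of θ at first coordinate 0.
  have hχ3 := hχ2 (fun z => (θ z).comp ι) (by
    intro t ht y hy
    have hz : (t, y) ∈ J ×ˢ J ×ˢ J := ⟨ht, hy⟩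
    have h1 : HasDerivAt (fun s : ℝ => (s, y)) ((1 : ℝ), (0 : ℝ × ℝ)) t :=
      (hasDerivAt_id t).prodMk (hasDerivAt_const t y)
    have h2 : HasDerivAt (fun s => θ (s, y)) (fderiv ℝ θ (t, y) (1, 0)) t :=
      (hθ' _ hz).comp_hasDerivAt t h1
    have h2' := h2.clm_comp (hasDerivAt_const t ι)
    have h3 : fderiv ℝ K (t, y) = (fderiv ℝ θ (t, y)).flip (1, 0) := by
      have := ((hθ' _ hz).clm_apply (hasFDerivAt_const ((1 : ℝ), (0 : ℝ × ℝ)) (t, y))).fderiv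
      simpa using this
    refine h2'.congr_deriv ?_
    rw [h3]
    refine ContinuousLinearMap.ext fun w => ?_
    have h4 := hd _ hz (ι w)
    rw [extD, sub_eq_zero] at h4
    simp only [ContinuousLinearMap.comp_apply, ContinuousLinearMap.flip_apply, ← h4]
    simp)
  have hdχ : ∀ z ∈ J ×ˢ J ×ˢ J, ∀ w, θ z w = fderiv ℝ χ z w + θ (0, z.2) (ι w.2) := by
    rintro ⟨t, y⟩ hz w
    have h := ((hχ.contDiffAt (hQ.mem_nhds hz)).differentiableAt htop).hasFDerivAt
    have h1 : HasDerivAt (fun s : ℝ => (s, y)) ((1 : ℝ), (0 : ℝ × ℝ)) t :=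
      (hasDerivAt_id t).prodMk (hasDerivAt_const t y)
    have h2 := (h.comp_hasDerivAt t h1).unique (hχ1 t hz.1 y hz.2)
    have h3 := (h.comp y (hasFDerivAt_prodMk_right t y)).unique (hχ3 t hz.1 y hz.2)
    have h4 := DFunLike.congr_fun h3 w.2
    have h5 : w = w.1 • (1, 0) + ι w.2 := by ext <;> simp [ι]
    simp only [ContinuousLinearMap.comp_apply, sub_apply] at h4
    change fderiv ℝ χ (t, y) (ι w.2) = _ at h4
    nth_rewrite 1 2 [h5]
    rw [map_add, map_add, map_smul, map_smul, h2, h4]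
    simp only [K]; ring
  set b : ℝ × ℝ → (ℝ × ℝ) →L[ℝ] ℝ := fun y => (θ (0, y)).comp ι with hb
  have hbs : ContDiffOn ℝ ∞ b (J ×ˢ J) :=
    (hθ.comp (by fun_prop) fun y hy => ⟨h0, hy⟩).clm_comp contDiffOn_const
  -- In two variables, subtracting dκ removes the first component of b and leaves a multiple of the
  -- second coordinate differential; its coefficient is φ.
  obtain ⟨κ, hκ, hκ1, -⟩ := exists_primitive_first (K := fun y => b y (1, 0)) hJ hJc h0 hJ
    (hbs.clm_apply contDiffOn_const)
  have hκ' : ∀ y ∈ J ×ˢ J, HasFDerivAt κ (fderiv ℝ κ y) y := fun y hy =>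
    ((hκ.contDiffAt (hJJ.mem_nhds hy)).differentiableAt htop).hasFDerivAt
  refine ⟨fun z => χ z + κ z.2, fun y => b y (0, 1) - fderiv ℝ κ y (0, 1), ?_, ?_, ?_⟩
  · exact hχ.add (hκ.comp (by fun_prop) fun z hz => hz.2)
  · exact (hbs.clm_apply contDiffOn_const).sub
      ((hκ.fderiv_of_isOpen hJJ (by simp)).clm_apply contDiffOn_const)
  · rintro ⟨t, y⟩ hz w
    have h := ((hχ.contDiffAt (hQ.mem_nhds hz)).differentiableAt htop).hasFDerivAt
    have h1 : HasFDerivAt (fun z : ℝ × ℝ × ℝ => κ z.2)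
        ((fderiv ℝ κ y).comp (ContinuousLinearMap.snd ℝ ℝ (ℝ × ℝ))) (t, y) :=
      HasFDerivAt.comp (g := κ) (t, y) (hκ' y hz.2) hasFDerivAt_snd
    have h2 : HasDerivAt (fun s : ℝ => (s, y.2)) ((1 : ℝ), (0 : ℝ)) y.1 :=
      (hasDerivAt_id y.1).prodMk (hasDerivAt_const y.1 y.2)
    have h3 := ((hκ' y hz.2).comp_hasDerivAt y.1 h2).unique (hκ1 y.1 hz.2.1 y.2 hz.2.2)
    have h7 : HasFDerivAt (fun z : ℝ × ℝ × ℝ => χ z + κ z.2) _ (t, y) := h.add h1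
    rw [hdχ _ hz, h7.fderiv]
    have h5 : w.2 = w.2.1 • (1, 0) + w.2.2 • (0, 1) := by ext <;> simp
    have h6 : θ (0, y) (ι w.2) = b y w.2 := rfl
    simp only [add_apply, ContinuousLinearMap.comp_apply, ContinuousLinearMap.coe_snd']
    rw [h6, h5, map_add, map_add, map_smul, map_smul, map_smul, map_smul, h3]
    simp only [smul_eq_mul]
    simp
    ring

end NormalForm

/-! ### The curl as the exterior derivative of the dual 1-form. -/

section Curl

/-- The 1-form dual to a vector field. -/
def flat (v : E3 → E3) (x : E3) : E3 →L[ℝ] ℝ := innerSL ℝ (v x)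

theorem flat_apply (v : E3 → E3) (x h : E3) : flat v x h = inner ℝ (v x) h := rfl

theorem hasFDerivAt_flat {v : E3 → E3} {x : E3} (hv : DifferentiableAt ℝ v x) :
    HasFDerivAt (flat v) ((innerSL ℝ).comp (fderiv ℝ v x)) x :=
  (innerSL ℝ (E := E3)).hasFDerivAt.comp x hv.hasFDerivAt

theorem ContDiffOn.flat {v : E3 → E3} {B : Set E3} (hv : ContDiffOn ℝ ∞ v B) :
    ContDiffOn ℝ ∞ (flat v) B :=
  (innerSL ℝ (E := E3)).contDiff.comp_contDiffOn hv

theorem E3.eq_sum_single (h : E3) : h = h 0 • EuclideanSpace.single 0 1 +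
    h 1 • EuclideanSpace.single 1 1 + h 2 • EuclideanSpace.single 2 1 := by
  ext i; fin_cases i <;> simp

theorem fderiv_apply_coord (v : E3 → E3) (x h : E3) (i : Fin 3) :
    fderiv ℝ v x h i = h 0 * partialD v 0 i x + h 1 * partialD v 1 i x + h 2 * partialD v 2 i x := by
  conv_lhs => rw [E3.eq_sum_single h]
  simp [partialD]

theorem extD_flat {v : E3 → E3} {x : E3} (hv : DifferentiableAt ℝ v x) (h k : E3) :
    extD (flat v) x h k = inner ℝ (fderiv ℝ v x h) k - inner ℝ (fderiv ℝ v x k) h := by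
  rw [extD, (hasFDerivAt_flat hv).fderiv]; rfl

/-- The right-hand side is the triple product curl v · (h × k). Thus the curl spans the kernel of
the vorticity form wherever it is nonzero. -/
theorem extD_flat_eq_curl {v : E3 → E3} {x : E3} (hv : DifferentiableAt ℝ v x) (h k : E3) :
    extD (flat v) x h k = curl v x 0 * (h 1 * k 2 - h 2 * k 1) +
      curl v x 1 * (h 2 * k 0 - h 0 * k 2) + curl v x 2 * (h 0 * k 1 - h 1 * k 0) := by
  rw [extD_flat hv]
  simp only [PiLp.inner_apply, Fin.sum_univ_three, fderiv_apply_coord, curl]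
  simp
  ring

theorem curl_eq_zero_of_extD {v : E3 → E3} {x : E3} (hv : DifferentiableAt ℝ v x)
    (h : ∀ k l, extD (flat v) x k l = 0) : curl v x = 0 := by
  ext i
  fin_cases i
  · simpa [extD_flat_eq_curl hv] using h (EuclideanSpace.single 1 1) (EuclideanSpace.single 2 1)
  · simpa [extD_flat_eq_curl hv] using h (EuclideanSpace.single 2 1) (EuclideanSpace.single 0 1)
  · simpa [extD_flat_eq_curl hv] using h (EuclideanSpace.single 0 1) (EuclideanSpace.single 1 1)

theorem extD_flat_smul_curl {v : E3 → E3} {x : E3} (hv : DifferentiableAt ℝ v x) (c : ℝ)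
    (k : E3) : extD (flat v) x (c • curl v x) k = 0 := by
  rw [extD_flat_eq_curl hv]; simp; ring

/-- The hypothesis says that curl v × h = 0; the factor is the coefficient of the orthogonal
projection of h onto the curl. -/
theorem exists_eq_smul_curl {v : E3 → E3} {x : E3} (hv : DifferentiableAt ℝ v x)
    (hc : curl v x ≠ 0) {h : E3} (hh : ∀ k, extD (flat v) x h k = 0) :
    ∃ c : ℝ, h = c • curl v x := by
  have h0 := hh (EuclideanSpace.single 0 1)
  have h1 := hh (EuclideanSpace.single 1 1)
  have h2 := hh (EuclideanSpace.single 2 1)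
  rw [extD_flat_eq_curl hv] at h0 h1 h2
  simp at h0 h1 h2
  set w := curl v x
  have hw : w 0 ^ 2 + w 1 ^ 2 + w 2 ^ 2 ≠ 0 := by
    intro hz
    apply hc
    ext i
    fin_cases i <;> simp <;> nlinarith [sq_nonneg (w 0), sq_nonneg (w 1), sq_nonneg (w 2)]
  refine ⟨(h 0 * w 0 + h 1 * w 1 + h 2 * w 2) / (w 0 ^ 2 + w 1 ^ 2 + w 2 ^ 2), ?_⟩
  ext i
  fin_cases i <;> simp <;> field_simp
  · linear_combination w 2 * h1 - w 1 * h2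
  · linear_combination w 0 * h2 - w 2 * h0
  · linear_combination w 1 * h0 - w 0 * h1

theorem ContDiffOn.curl {v : E3 → E3} {B : Set E3} (hB : IsOpen B) (hv : ContDiffOn ℝ ∞ v B) :
    ContDiffOn ℝ ∞ (curl v) B := by
  have h : ∀ i j, ContDiffOn ℝ ∞ (partialD v i j) B := fun i j =>
    (EuclideanSpace.proj (𝕜 := ℝ) j : E3 →L[ℝ] ℝ).contDiff.comp_contDiffOn
      ((hv.fderiv_of_isOpen hB (by simp)).clm_apply contDiffOn_const)
  rw [contDiffOn_euclidean]
  intro i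
  fin_cases i <;> exact (h _ _).sub (h _ _)

end Curl

/-! ### The Clebsch representation of a single field. -/

section Darboux

/-- A rescaled arctangent. Vortex lines are parametrised by all of ℝ, while a flow box only offers a
bounded interval. -/
theorem exists_contDiff_range_Ioo {ε : ℝ} (hε : 0 < ε) : ∃ σ : ℝ → ℝ, ContDiff ℝ ∞ σ ∧
    (∀ r, σ r ∈ Ioo (-ε) ε) ∧ (∀ r, deriv σ r ≠ 0) ∧ ∀ s ∈ Ioo (-ε) ε, s ∈ range σ := by
  have hπ := Real.pi_pos
  have hc : 0 < 2 * ε / Real.pi := by positivity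
  have hcπ : 2 * ε / Real.pi * (Real.pi / 2) = ε := by field_simp
  refine ⟨fun r => 2 * ε / Real.pi * Real.arctan r, contDiff_const.mul Real.contDiff_arctan,
    fun r => ⟨?_, ?_⟩, fun r => ?_, fun s hs => ⟨Real.tan (Real.pi / (2 * ε) * s), ?_⟩⟩
  · nlinarith [mul_lt_mul_of_pos_left (Real.neg_pi_div_two_lt_arctan r) hc]
  · nlinarith [mul_lt_mul_of_pos_left (Real.arctan_lt_pi_div_two r) hc]
  · rw [((Real.hasDerivAt_arctan r).const_mul _).deriv]
    positivity
  · have hd : 0 < Real.pi / (2 * ε) := by positivity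
    have hdπ : Real.pi / (2 * ε) * ε = Real.pi / 2 := by field_simp
    simp only
    rw [Real.arctan_tan]
    · field_simp
    · nlinarith [mul_lt_mul_of_pos_left hs.1 hd]
    · nlinarith [mul_lt_mul_of_pos_left hs.2 hd]

/-- The local Clebsch representation of a vector field with nonvanishing curl, in a
neighbourhood where the common level sets of the two potentials are regular curves. -/
theorem exists_local_clebsch {B : Set E3} (hB : IsOpen B) {v : E3 → E3}
    (hv : ContDiffOn ℝ ∞ v B) {a : E3} (ha : a ∈ B) (hcurl : curl v a ≠ 0) :
    ∃ (U : Set E3) (f φ ψ : E3 → ℝ), IsOpen U ∧ a ∈ U ∧ U ⊆ B ∧ ContDiffOn ℝ ∞ f U ∧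
      ContDiffOn ℝ ∞ φ U ∧ ContDiffOn ℝ ∞ ψ U ∧ (∀ x ∈ U, curl v x ≠ 0) ∧
      (∀ x ∈ U, flat v x = fderiv ℝ f x + φ x • fderiv ℝ ψ x) ∧
      ∀ x ∈ U, ∀ y ∈ U, φ x = φ y → ψ x = ψ y → ∃ γ : ℝ → E3, ContDiff ℝ ∞ γ ∧
        (∀ s, γ s ∈ U ∧ deriv γ s ≠ 0 ∧ φ (γ s) = φ x ∧ ψ (γ s) = ψ x) ∧
        x ∈ range γ ∧ y ∈ range γ := by
  have htop : (∞ : WithTop ℕ∞) ≠ 0 := by simp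
  have hω := hv.curl hB
  set B' : Set E3 := B ∩ curl v ⁻¹' {0}ᶜ with hB'
  have hB'o : IsOpen B' := hω.continuousOn.isOpen_inter_preimage hB isOpen_compl_singleton
  have hvd : ∀ x ∈ B, DifferentiableAt ℝ v x := fun x hx =>
    (hv.contDiffAt (hB.mem_nhds hx)).differentiableAt htop
  obtain ⟨L, hL⟩ : ∃ L : (ℝ × ℝ × ℝ) ≃L[ℝ] E3, L (1, 0) = curl v a := by
    have hr : Module.finrank ℝ (ℝ × ℝ × ℝ) = Module.finrank ℝ E3 := by simp
    let T := ContinuousLinearEquiv.ofFinrankEq hr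
    obtain ⟨A, hA⟩ := SeparatingDual.exists_continuousLinearEquiv_apply_eq (R := ℝ)
      (x := T (1, 0)) (y := curl v a) (by simp) hcurl
    exact ⟨T.trans A, hA⟩
  obtain ⟨e, he0, hea, het, hes, hesymm, hed⟩ := exists_flowBox hB'o (hω.mono inter_subset_left)
    (a := a) ⟨ha, hcurl⟩ L hL
  obtain ⟨ε, hε, hεs⟩ := Metric.isOpen_iff.1 e.open_source _ he0
  set J := Ioo (-ε) ε with hJdef
  have hJ : IsOpen J := isOpen_Ioo
  have h0 : (0 : ℝ) ∈ J := by simpa [hJdef] using hε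
  have hJJ := hJ.prod hJ
  have hQ := hJ.prod hJJ
  have hQs : J ×ˢ J ×ˢ J ⊆ e.source := by
    refine Subset.trans ?_ hεs
    have hb : ball (0 : ℝ) ε = J := by rw [Real.ball_eq_Ioo]; simp [hJdef]
    rw [← ball_prod_same, Prod.zero_eq_mk, ← ball_prod_same, hb]
  have hes' : ∀ z ∈ J ×ˢ J ×ˢ J, ContDiffAt ℝ ∞ e z := fun z hz =>
    hes.contDiffAt (e.open_source.mem_nhds (hQs hz))
  have heB : ∀ z ∈ J ×ˢ J ×ˢ J, e z ∈ B' := fun z hz => het (e.map_source (hQs hz))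
  set θ : ℝ × ℝ × ℝ → (ℝ × ℝ × ℝ) →L[ℝ] ℝ := fun z => (flat v (e z)).comp (fderiv ℝ e z) with hθdef
  have hθ : ContDiffOn ℝ ∞ θ (J ×ˢ J ×ˢ J) :=
    (hv.flat.comp (hes.mono hQs) fun z hz => (heB z hz).1).clm_comp
      ((hes.fderiv_of_isOpen e.open_source (by simp)).mono hQs)
  have hdθ : ∀ z ∈ J ×ˢ J ×ˢ J, ∀ w w', extD θ z w w' =
      extD (flat v) (e z) (fderiv ℝ e z w) (fderiv ℝ e z w') := fun z hz w w' =>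
    extD_pullback (hes' z hz) (hasFDerivAt_flat (hvd _ (heB z hz).1)).differentiableAt w w'
  obtain ⟨f, φ, hf, hφ, hfφ⟩ := exists_clebsch_normalForm hJ ordConnected_Ioo h0 hθ
    (fun z hz w => by
      rw [hdθ z hz, hed z (hQs hz), ← one_smul ℝ (curl v (e z))]
      exact extD_flat_smul_curl (hvd _ (heB z hz).1) 1 _)
  have hinv : ∀ x ∈ e.target, ∀ h, fderiv ℝ e (e.symm x) (fderiv ℝ e.symm x h) = h := by
    intro x hx h
    have h1 := ((hes.contDiffAt (e.open_source.mem_nhds (e.map_target hx))).differentiableAt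
      htop).hasFDerivAt
    have h2 := ((hesymm.contDiffAt (e.open_target.mem_nhds hx)).differentiableAt htop).hasFDerivAt
    have h3 := (h1.comp x h2).unique ((hasFDerivAt_id x).congr_of_eventuallyEq ?_)
    · exact DFunLike.congr_fun h3 h
    · filter_upwards [e.open_target.mem_nhds hx] with y hy using e.right_inv hy
  -- If ∂φ/∂y₁ vanished, dφ would be a multiple of dy₂ = dψ, so dφ ∧ dψ and with it the curl would
  -- be zero. As φ does not depend on s, it suffices to look at s = 0.
  have hφ1 : ∀ y ∈ J ×ˢ J, fderiv ℝ φ y (1, 0) ≠ 0 := by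
    intro y hy h1
    have hz : (0, y) ∈ J ×ˢ J ×ˢ J := ⟨h0, hy⟩
    refine (heB _ hz).2 (curl_eq_zero_of_extD (hvd _ (heB _ hz).1) fun k l => ?_)
    have hx := e.map_source (hQs hz)
    have hk := hinv _ hx k
    have hl := hinv _ hx l
    rw [e.left_inv (hQs hz)] at hk hl
    rw [← hk, ← hl, ← hdθ _ hz]
    have hφs : ContDiffAt ℝ ∞ φ y := hφ.contDiffAt (hJJ.mem_nhds hy)
    have hφ2 : HasFDerivAt (fun z : ℝ × ℝ × ℝ => φ z.2)
        ((fderiv ℝ φ y).comp (ContinuousLinearMap.snd ℝ ℝ (ℝ × ℝ))) (0, y) :=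
      HasFDerivAt.comp (g := φ) (0, y) (hφs.differentiableAt htop).hasFDerivAt hasFDerivAt_snd
    have hψ : ∀ z : ℝ × ℝ × ℝ, fderiv ℝ (fun z : ℝ × ℝ × ℝ => z.2.2) z =
        (ContinuousLinearMap.snd ℝ ℝ ℝ).comp (ContinuousLinearMap.snd ℝ ℝ (ℝ × ℝ)) := fun z =>
      ((ContinuousLinearMap.snd ℝ ℝ ℝ).comp
        (ContinuousLinearMap.snd ℝ ℝ (ℝ × ℝ))).hasFDerivAt.fderiv
    rw [extD_clebsch (F := f) (φ := fun z => φ z.2) (ψ := fun z => z.2.2)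
      (hf.contDiffAt (hQ.mem_nhds hz)) (ContDiffAt.comp (0, y) hφs contDiffAt_snd)
      (contDiff_snd.snd.contDiffAt), hφ2.fderiv, hψ]
    · have h5 : ∀ w : ℝ × ℝ, fderiv ℝ φ y w = w.2 * fderiv ℝ φ y (0, 1) := by
        intro w
        have : w = w.1 • (1, 0) + w.2 • (0, 1) := by ext <;> simp
        conv_lhs => rw [this]
        rw [map_add, map_smul, map_smul, h1]
        simp
      simp only [ContinuousLinearMap.comp_apply, ContinuousLinearMap.coe_snd', h5 (Prod.snd _)]
      ring
    · filter_upwards [hQ.mem_nhds hz] with z hz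
      refine ContinuousLinearMap.ext fun w => ?_
      rw [hfφ z hz w, hψ]
      simp
  -- Rolle's theorem: two equal values would produce a zero of ∂φ/∂y₁.
  have hφinj : ∀ p ∈ J, ∀ q ∈ J, ∀ y ∈ J, φ (p, y) = φ (q, y) → p = q := by
    have hlt : ∀ p ∈ J, ∀ q ∈ J, ∀ y ∈ J, φ (p, y) = φ (q, y) → ¬ p < q := by
      intro p hp q hq y hy h hpq
      have hsub : Icc p q ⊆ J := fun r hr => ⟨hp.1.trans_le hr.1, hr.2.trans_lt hq.2⟩
      have hd : ∀ r ∈ J, HasDerivAt (fun r => φ (r, y)) (fderiv ℝ φ (r, y) (1, 0)) r := by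
        intro r hr
        have h1 : HasDerivAt (fun r : ℝ => (r, y)) ((1 : ℝ), (0 : ℝ)) r :=
          (hasDerivAt_id r).prodMk (hasDerivAt_const r y)
        exact ((hφ.contDiffAt (hJJ.mem_nhds ⟨hr, hy⟩)).differentiableAt
          htop).hasFDerivAt.comp_hasDerivAt r h1
      obtain ⟨r, hr, hr0⟩ := exists_hasDerivAt_eq_zero hpq
        (fun r hr => (hd r (hsub hr)).continuousAt.continuousWithinAt) h
        (fun r hr => hd r (hsub (Ioo_subset_Icc_self hr)))
      exact hφ1 (r, y) ⟨hsub (Ioo_subset_Icc_self hr), hy⟩ hr0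
    intro p hp q hq y hy h
    exact le_antisymm (not_lt.1 (hlt q hq p hp y hy h.symm)) (not_lt.1 (hlt p hp q hq y hy h))
  -- The cube shape matters: by `hφinj` the values of φ and ψ determine (y₁, y₂), and the remaining
  -- set of s is an interval, so each common level set in U is one connected curve.
  set U := e.target ∩ e.symm ⁻¹' (J ×ˢ J ×ˢ J) with hU
  have hUo : IsOpen U := hesymm.continuousOn.isOpen_inter_preimage e.open_target hQ
  have hUB : U ⊆ B' := fun x hx => het hx.1
  have hUs : ContDiffOn ℝ ∞ e.symm U := hesymm.mono inter_subset_left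
  have hz0 : e.symm a = (0, 0) := by rw [← hea]; exact e.left_inv he0
  refine ⟨U, fun x => f (e.symm x), fun x => φ (e.symm x).2, fun x => (e.symm x).2.2, hUo,
    ⟨?_, ?_⟩, hUB.trans inter_subset_left, hf.comp hUs fun x hx => hx.2,
    hφ.comp (contDiff_snd.comp_contDiffOn hUs) fun x hx => hx.2.2,
    contDiff_snd.snd.comp_contDiffOn hUs, fun x hx => (hUB hx).2, ?_, ?_⟩
  · rw [← hea]; exact e.map_source he0
  · rw [mem_preimage, hz0]; exact ⟨h0, h0, h0⟩
  · intro x hx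
    have h1 := ((hesymm.contDiffAt (e.open_target.mem_nhds hx.1)).differentiableAt htop).hasFDerivAt
    have h2 := ((hf.contDiffAt (hQ.mem_nhds hx.2)).differentiableAt htop).hasFDerivAt
    have h3 : HasFDerivAt (fun x => (e.symm x).2.2) _ x :=
      ((ContinuousLinearMap.snd ℝ ℝ ℝ).comp
        (ContinuousLinearMap.snd ℝ ℝ (ℝ × ℝ))).hasFDerivAt.comp x h1
    have h4 : HasFDerivAt (fun x => f (e.symm x)) _ x := h2.comp x h1
    refine ContinuousLinearMap.ext fun h => ?_
    have h5 := hfφ _ hx.2 (fderiv ℝ e.symm x h)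
    simp only [hθdef, ContinuousLinearMap.comp_apply, hinv x hx.1 h, e.right_inv hx.1] at h5
    rw [h5, h3.fderiv, h4.fderiv]
    simp
  · intro x hx y hy h1 h2
    have hxy : (e.symm x).2 = (e.symm y).2 := by
      refine Prod.ext (hφinj _ hx.2.2.1 _ hy.2.2.1 _ hy.2.2.2 ?_) h2
      change (e.symm x).2.2 = (e.symm y).2.2 at h2
      rw [Prod.mk.eta, ← h2, Prod.mk.eta]
      exact h1
    obtain ⟨σ, hσs, hσ, hσd, hσr⟩ := exists_contDiff_range_Ioo hε
    have hmem : ∀ r, (σ r, (e.symm x).2) ∈ J ×ˢ J ×ˢ J := fun r => ⟨hσ r, hx.2.2⟩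
    have hγU : ∀ r, e (σ r, (e.symm x).2) ∈ U := fun r =>
      ⟨e.map_source (hQs (hmem r)), by rw [mem_preimage, e.left_inv (hQs (hmem r))]; exact hmem r⟩
    refine ⟨fun r => e (σ r, (e.symm x).2), ?_, fun r => ⟨hγU r, ?_, ?_, ?_⟩, ?_, ?_⟩
    · rw [← contDiffOn_univ]
      exact hes.comp (hσs.prodMk contDiff_const).contDiffOn fun r _ => hQs (hmem r)
    · have h3 : HasDerivAt (fun r => (σ r, (e.symm x).2)) (deriv σ r, 0) r :=
        ((hσs.differentiable htop r).hasDerivAt).prodMk (hasDerivAt_const r _)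
      have h4 := ((hes' _ (hmem r)).differentiableAt htop).hasFDerivAt.comp_hasDerivAt r h3
      have h5 : (deriv σ r, (0 : ℝ × ℝ)) = deriv σ r • (1, 0) := by simp
      rw [h5, map_smul, hed _ (hQs (hmem r))] at h4
      have h6 := h4.deriv
      simp only [Function.comp_def] at h6
      rw [h6]
      exact smul_ne_zero (hσd r) (heB _ (hmem r)).2
    · simp only [e.left_inv (hQs (hmem r))]
    · simp only [e.left_inv (hQs (hmem r))]
    · obtain ⟨r, hr⟩ := hσr _ hx.2.1
      exact ⟨r, by simp only [hr, Prod.mk.eta]; exact e.right_inv hx.1⟩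
    · obtain ⟨r, hr⟩ := hσr _ hy.2.1
      exact ⟨r, by simp only [hr, hxy, Prod.mk.eta]; exact e.right_inv hy.1⟩

end Darboux

/-! ### Partial and material derivatives. -/

section Partial

variable {E F : Type*} [NormedAddCommGroup E] [NormedSpace ℝ E] [NormedAddCommGroup F]
  [NormedSpace ℝ F] {f : ℝ → E → F} {t : ℝ} {x : E}

theorem hasDerivAt_uncurry_fst (h : DifferentiableAt ℝ (uncurry f) (t, x)) :
    HasDerivAt (fun s => f s x) (fderiv ℝ (uncurry f) (t, x) (1, 0)) t := by
  have h1 : HasDerivAt (fun s : ℝ => (s, x)) ((1 : ℝ), (0 : E)) t :=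
    (hasDerivAt_id t).prodMk (hasDerivAt_const t x)
  exact h.hasFDerivAt.comp_hasDerivAt t h1

theorem hasFDerivAt_uncurry_snd (h : DifferentiableAt ℝ (uncurry f) (t, x)) :
    HasFDerivAt (f t) ((fderiv ℝ (uncurry f) (t, x)).comp (ContinuousLinearMap.inr ℝ ℝ E)) x :=
  h.hasFDerivAt.comp x (hasFDerivAt_prodMk_right t x)

theorem fderiv_uncurry_apply (h : DifferentiableAt ℝ (uncurry f) (t, x)) (r : ℝ) (w : E) :
    fderiv ℝ (uncurry f) (t, x) (r, w) = r • deriv (fun s => f s x) t + fderiv ℝ (f t) x w := by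
  have h1 : ((r, w) : ℝ × E) = r • (1, 0) + ContinuousLinearMap.inr ℝ ℝ E w := by simp
  rw [h1, map_add, map_smul, (hasDerivAt_uncurry_fst h).deriv, (hasFDerivAt_uncurry_snd h).fderiv]
  rfl

/-- The material derivative. -/
theorem hasDerivAt_along (h : DifferentiableAt ℝ (uncurry f) (t, x)) {c : ℝ → E} {c' : E}
    (hc : HasDerivAt c c' t) (hx : c t = x) :
    HasDerivAt (fun s => f s (c s)) (deriv (fun s => f s x) t + fderiv ℝ (f t) x c') t := by
  subst hx
  have h1 := h.hasFDerivAt.comp_hasDerivAt t ((hasDerivAt_id t).prodMk hc)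
  rw [fderiv_uncurry_apply h, one_smul] at h1
  exact h1

end Partial

theorem inner_gradient_eq_fderiv (f : E3 → ℝ) (x h : E3) : inner ℝ (∇ f x) h = fderiv ℝ f x h := by
  rw [← toDual_gradient]; rfl

/-! ### The space-time map and the smoothness of particle labels. -/

namespace FluidMotion

variable {M : FluidMotion}

theorem mem_tube {U : Set E3} {t : ℝ} {a : E3} (ht : t ∈ M.times) (ha : a ∈ U) :
    (t, M.X t a) ∈ M.tube U := ⟨ht, a, ha, rfl⟩

theorem exists_of_mem_tube {U : Set E3} {q : ℝ × E3} (hq : q ∈ M.tube U) :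
    ∃ t ∈ M.times, ∃ a ∈ U, q = (t, M.X t a) := by
  obtain ⟨ht, a, ha, h⟩ := hq
  exact ⟨q.1, ht, a, ha, Prod.ext rfl h.symm⟩

theorem tube_mono {U V : Set E3} (h : U ⊆ V) : M.tube U ⊆ M.tube V :=
  fun _ hq => ⟨hq.1, image_mono h hq.2⟩

theorem differentiableAt_X {t : ℝ} {a : E3} (ht : t ∈ M.times) (ha : a ∈ M.particles) :
    DifferentiableAt ℝ (uncurry M.X) (t, a) :=
  (M.smooth.contDiffAt ((M.times_open.prod M.particles_open).mem_nhds ⟨ht, ha⟩)).differentiableAt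
    (by simp)

theorem contDiffAt_X {t : ℝ} {a : E3} (ht : t ∈ M.times) (ha : a ∈ M.particles) :
    ContDiffAt ℝ ∞ (M.X t) a :=
  (M.smooth.contDiffAt ((M.times_open.prod M.particles_open).mem_nhds ⟨ht, ha⟩)).comp a
    (contDiffAt_const.prodMk contDiffAt_id)

theorem hasFDerivAt_X {t : ℝ} {a : E3} (ht : t ∈ M.times) (ha : a ∈ M.particles) :
    HasFDerivAt (M.X t) (fderiv ℝ (M.X t) a) a :=
  ((contDiffAt_X ht ha).differentiableAt (by simp)).hasFDerivAt

variable (M) in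
/-- The map of space-time which puts the particles at their positions. -/
def spaceTime (q : ℝ × E3) : ℝ × E3 := (q.1, M.X q.1 q.2)

theorem contDiffOn_spaceTime : ContDiffOn ℝ ∞ M.spaceTime (M.times ×ˢ M.particles) :=
  contDiffOn_fst.prodMk M.smooth

theorem injOn_spaceTime : InjOn M.spaceTime (M.times ×ˢ M.particles) := by
  rintro ⟨t, a⟩ ⟨ht, ha⟩ ⟨s, b⟩ ⟨-, hb⟩ h
  obtain ⟨h1, h2⟩ := Prod.mk.inj h
  subst h1
  exact Prod.ext rfl (M.injective t ht ha hb h2)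

theorem exists_equiv_fderiv {t : ℝ} {a : E3} (ht : t ∈ M.times) (ha : a ∈ M.particles) :
    ∃ A : E3 ≃L[ℝ] E3, (A : E3 →L[ℝ] E3) = fderiv ℝ (M.X t) a :=
  ⟨(fderiv ℝ (M.X t) a).toContinuousLinearEquivOfDetNeZero (M.jacobian_pos t ht a ha).ne', by simp⟩

/-- The derivative of (t, a) ↦ (t, X_t a) is block triangular with diagonal blocks 1 and DX_t, and
the latter is invertible because its determinant is positive. -/
theorem exists_local_spaceTime {U : Set E3} (hU : IsOpen U) (hUM : U ⊆ M.particles) {t : ℝ}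
    {a : E3} (ht : t ∈ M.times) (ha : a ∈ U) :
    ∃ e : OpenPartialHomeomorph (ℝ × E3) (ℝ × E3), ⇑e = M.spaceTime ∧ (t, a) ∈ e.source ∧
      e.source ⊆ M.times ×ˢ U ∧ ContDiffOn ℝ ∞ e.symm e.target := by
  obtain ⟨A, hA⟩ := exists_equiv_fderiv ht (hUM ha)
  refine exists_openPartialHomeomorph_contDiffOn (M.times_open.prod hU)
    (contDiffOn_spaceTime.mono (prod_mono_right hUM)) ⟨ht, ha⟩
    ((ContinuousLinearEquiv.refl ℝ ℝ).skewProd A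
      ((ContinuousLinearMap.id ℝ ℝ).smulRight (deriv (fun s => M.X s a) t))) ?_
  have h := differentiableAt_X ht (hUM ha)
  have h1 : HasFDerivAt M.spaceTime _ (t, a) := hasFDerivAt_fst.prodMk h.hasFDerivAt
  refine h1.congr_fderiv (ContinuousLinearMap.ext fun w => ?_)
  refine Prod.ext rfl ?_
  have h2 := DFunLike.congr_fun hA w.2
  have h3 := fderiv_uncurry_apply h w.1 w.2
  simp only [ContinuousLinearEquiv.coe_coe] at h2
  simp [h2, h3, add_comm]

theorem isOpen_tube {U : Set E3} (hU : IsOpen U) (hUM : U ⊆ M.particles) : IsOpen (M.tube U) := by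
  rw [isOpen_iff_mem_nhds]
  intro q hq
  obtain ⟨t, ht, a, ha, rfl⟩ := exists_of_mem_tube hq
  obtain ⟨e, he, hs, hsub, -⟩ := exists_local_spaceTime hU hUM ht ha
  have h1 : M.spaceTime (t, a) ∈ e.target := by rw [← he]; exact e.map_source hs
  refine mem_of_superset (e.open_target.mem_nhds h1) fun q hq => ?_
  have h2 := hsub (e.map_target hq)
  rw [← e.right_inv hq, he]
  exact mem_tube h2.1 h2.2

theorem isOpen_region : IsOpen M.region := isOpen_tube M.particles_open Subset.rfl

variable (M) in
/-- The label of the particle at a given point of space-time. -/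
def label (q : ℝ × E3) : E3 := (invFunOn M.spaceTime (M.times ×ˢ M.particles) q).2

theorem label_X {t : ℝ} {a : E3} (ht : t ∈ M.times) (ha : a ∈ M.particles) :
    M.label (t, M.X t a) = a :=
  congrArg Prod.snd (injOn_spaceTime.leftInvOn_invFunOn (show (t, a) ∈ _ from ⟨ht, ha⟩))

theorem label_mem {U : Set E3} (hUM : U ⊆ M.particles) {q : ℝ × E3} (hq : q ∈ M.tube U) :
    M.label q ∈ U := by
  obtain ⟨t, ht, a, ha, rfl⟩ := exists_of_mem_tube hq
  rwa [label_X ht (hUM ha)]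

theorem contDiffOn_label : ContDiffOn ℝ ∞ M.label M.region := by
  intro q hq
  obtain ⟨t, ht, a, ha, rfl⟩ := exists_of_mem_tube hq
  obtain ⟨e, he, hs, hsub, hes⟩ := exists_local_spaceTime M.particles_open Subset.rfl ht ha
  have h1 : M.spaceTime (t, a) ∈ e.target := by rw [← he]; exact e.map_source hs
  have h2 := e.open_target.mem_nhds h1
  refine ((contDiff_snd.contDiffAt.comp _ (hes.contDiffAt h2)).congr_of_eventuallyEq
    ?_).contDiffWithinAt
  filter_upwards [h2] with q hq
  have h3 := hsub (e.map_target hq)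
  have h4 := label_X h3.1 h3.2
  change M.label (M.spaceTime (e.symm q)) = _ at h4
  rwa [← he, e.right_inv hq] at h4

theorem eventually_mem_image {U : Set E3} (hU : IsOpen U) (hUM : U ⊆ M.particles) {t : ℝ} {x : E3}
    (hx : (t, x) ∈ M.tube U) : ∀ᶠ y in 𝓝 x, (t, y) ∈ M.tube U :=
  (continuous_const.prodMk continuous_id).continuousAt.eventually
    ((isOpen_tube hU hUM).mem_nhds hx)

theorem contDiffAt_slice {F : Type*} [NormedAddCommGroup F] [NormedSpace ℝ F] {U : Set E3}
    (hU : IsOpen U) (hUM : U ⊆ M.particles) {f : ℝ → E3 → F}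
    (hf : ContDiffOn ℝ ∞ (uncurry f) (M.tube U)) {t : ℝ} {x : E3} (hx : (t, x) ∈ M.tube U) :
    ContDiffAt ℝ ∞ (f t) x :=
  (hf.contDiffAt ((isOpen_tube hU hUM).mem_nhds hx)).comp x (contDiffAt_const.prodMk contDiffAt_id)

end FluidMotion

/-! ### Dynamics: pressure function, Weber's identity, transport of vorticity. -/

open FluidMotion

/-- The pressure function, whose gradient is the pressure force per unit of mass. -/
theorem exists_pressureFunction {M : FluidMotion} {u : ℝ → E3 → E3} {ρ p V : ℝ → E3 → ℝ}
    (hflow : IsIdealFlow M u ρ p V) (hlaw : IsLiquid M ρ ∨ IsElastic M ρ p) :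
    ∃ P : ℝ → E3 → ℝ, ContDiffOn ℝ ∞ (uncurry P) M.region ∧
      ∀ t x, (t, x) ∈ M.region → fderiv ℝ (p t) x = ρ t x • fderiv ℝ (P t) x := by
  have hpd : ∀ t x, (t, x) ∈ M.region → DifferentiableAt ℝ (p t) x := fun t x h =>
    (contDiffAt_slice M.particles_open Subset.rfl hflow.smooth_pressure h).differentiableAt
      (by simp)
  rcases hlaw with ⟨ρ₀, hρ⟩ | ⟨J, G, hJ, hJc, hG, hGpos, hpG⟩
  · refine ⟨fun t x => ρ₀⁻¹ * p t x, contDiffOn_const.mul hflow.smooth_pressure, fun t x h => ?_⟩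
    have h0 := (hflow.density_pos t x h).ne'
    rw [hρ t x h] at h0 ⊢
    rw [fderiv_const_mul (hpd t x h), smul_inv_smul₀ h0]
  -- P = H(p) with H' = 1/G gives dP = dp/ϱ. If J is empty there is no base point for the primitive,
  -- but then nothing is required of H.
  · obtain ⟨H, hH⟩ : ∃ H : ℝ → ℝ, ∀ s ∈ J, HasDerivAt H (G s)⁻¹ s := by
      rcases J.eq_empty_or_nonempty with rfl | ⟨s₀, hs₀⟩
      · exact ⟨0, by simp⟩
      have hc : ContinuousOn (fun s => (G s)⁻¹) J :=
        hG.continuousOn.inv₀ fun s hs => (hGpos s hs).ne'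
      refine ⟨fun s => ∫ r in s₀..s, (G r)⁻¹, fun s hs => ?_⟩
      exact intervalIntegral.integral_hasDerivAt_right
        (hc.mono (hJc.uIcc_subset hs₀ hs)).intervalIntegrable
        (hc.stronglyMeasurableAtFilter hJ s hs) (hc.continuousAt (hJ.mem_nhds hs))
    have hHs : ContDiffOn ℝ ∞ H J := by
      rw [contDiffOn_infty_iff_deriv_of_isOpen hJ]
      exact ⟨fun s hs => (hH s hs).differentiableAt.differentiableWithinAt,
        (hG.inv fun s hs => (hGpos s hs).ne').congr fun s hs => (hH s hs).deriv⟩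
    refine ⟨fun t x => H (p t x), hHs.comp hflow.smooth_pressure fun q hq => (hpG q.1 q.2 hq).1,
      fun t x h => ?_⟩
    have h1 := (hH _ (hpG t x h).1).comp_hasFDerivAt x (hpd t x h).hasFDerivAt
    have h2 := h1.fderiv
    simp only [Function.comp_def] at h2
    rw [h2, (hpG t x h).2, smul_inv_smul₀ (hGpos _ (hpG t x h).1).ne']

namespace IsIdealFlow

variable {M : FluidMotion} {u : ℝ → E3 → E3} {ρ p V : ℝ → E3 → ℝ}

/-- The velocity form pulled back to the particle labels. -/
def labelForm (M : FluidMotion) (u : ℝ → E3 → E3) (q : ℝ × E3) : E3 →L[ℝ] ℝ :=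
  (flat (u q.1) (M.X q.1 q.2)).comp (fderiv ℝ (M.X q.1) q.2)

theorem differentiableAt_velocity (hflow : IsIdealFlow M u ρ p V) {t : ℝ} {x : E3}
    (h : (t, x) ∈ M.region) : DifferentiableAt ℝ (u t) x :=
  (contDiffAt_slice M.particles_open Subset.rfl hflow.smooth_velocity h).differentiableAt (by simp)

/-- Differentiating ∂_t X_t = u(t, X_t) in the label and interchanging the mixed second derivatives
of X. -/
theorem hasDerivAt_fderiv_X (hflow : IsIdealFlow M u ρ p V) {t : ℝ} {a : E3} (ht : t ∈ M.times)
    (ha : a ∈ M.particles) : HasDerivAt (fun s => fderiv ℝ (M.X s) a)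
      ((fderiv ℝ (u t) (M.X t a)).comp (fderiv ℝ (M.X t) a)) t := by
  have hO := M.times_open.prod M.particles_open
  have hX : ContDiffAt ℝ ∞ (uncurry M.X) (t, a) :=
    M.smooth.contDiffAt (hO.mem_nhds ⟨ht, ha⟩)
  have hD : DifferentiableAt ℝ (fderiv ℝ (uncurry M.X)) (t, a) :=
    (hX.fderiv_right (m := ∞) (by simp)).differentiableAt (by simp)
  have h1 : HasDerivAt (fun s : ℝ => fderiv ℝ (uncurry M.X) (s, a))
      (fderiv ℝ (fderiv ℝ (uncurry M.X)) (t, a) (1, 0)) t :=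
    hasDerivAt_uncurry_fst (f := fun s b => fderiv ℝ (uncurry M.X) (s, b)) hD
  have h2 := h1.clm_comp (hasDerivAt_const t (ContinuousLinearMap.inr ℝ ℝ E3))
  refine (h2.congr_of_eventuallyEq ?_).congr_deriv (ContinuousLinearMap.ext fun k => ?_)
  · filter_upwards [M.times_open.mem_nhds ht] with s hs
    exact (hasFDerivAt_uncurry_snd (differentiableAt_X hs ha)).fderiv
  · have h3 := (hX.isSymmSndFDerivAt (by simp; norm_cast)).eq (1, 0)
      (ContinuousLinearMap.inr ℝ ℝ E3 k)
    have h4 : HasFDerivAt (fun q => fderiv ℝ (uncurry M.X) q (1, 0))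
        ((fderiv ℝ (fderiv ℝ (uncurry M.X)) (t, a)).flip (1, 0)) (t, a) := by
      have := hD.hasFDerivAt.clm_apply (hasFDerivAt_const ((1 : ℝ), (0 : E3)) (t, a))
      simpa using this
    have h5 : HasFDerivAt (fun b => fderiv ℝ (uncurry M.X) (t, b) (1, 0))
        (((fderiv ℝ (fderiv ℝ (uncurry M.X)) (t, a)).flip (1, 0)).comp
          (ContinuousLinearMap.inr ℝ ℝ E3)) a := h4.comp a (hasFDerivAt_prodMk_right t a)
    have h6 : HasFDerivAt (fun b => u t (M.X t b))
        ((fderiv ℝ (u t) (M.X t a)).comp (fderiv ℝ (M.X t) a)) a :=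
      (hflow.differentiableAt_velocity (mem_tube ht ha)).hasFDerivAt.comp a (hasFDerivAt_X ht ha)
    have h7 := h5.unique (h6.congr_of_eventuallyEq ?_)
    · rw [← h7]
      simpa using h3
    · filter_upwards [M.particles_open.mem_nhds ha] with b hb
      exact (hasDerivAt_uncurry_fst (differentiableAt_X ht hb)).unique (hflow.velocity t ht b hb)

/-- The pulled back velocity form changes by exact forms only. -/
theorem exists_weber_potential (hflow : IsIdealFlow M u ρ p V)
    (hlaw : IsLiquid M ρ ∨ IsElastic M ρ p) :
    ∃ χ : ℝ × E3 → ℝ, ContDiffOn ℝ ∞ χ (M.times ×ˢ M.particles) ∧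
      ∀ t ∈ M.times, ∀ a ∈ M.particles,
        HasFDerivAt (fun b => χ (t, b)) (labelForm M u (t, a) - flat (u 0) a) a := by
  obtain ⟨P, hP, hpP⟩ := exists_pressureFunction hflow hlaw
  have hO := M.times_open.prod M.particles_open
  -- In the time derivative of X_t^*(u♭), the acceleration contributes d(V − P) by Euler's equation,
  -- and the change of DX_t contributes ⟨u, Du ·⟩ = d(|u|²/2).
  set κ : ℝ → E3 → ℝ := fun t x => V t x - P t x + 1 / 2 * inner ℝ (u t x) (u t x) with hκdef
  have hκ : ContDiffOn ℝ ∞ (uncurry κ) M.region :=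
    (hflow.smooth_potential.sub hP).add (contDiffOn_const.mul
      (hflow.smooth_velocity.inner ℝ hflow.smooth_velocity))
  set K : ℝ × E3 → ℝ := fun q => uncurry κ (M.spaceTime q) with hKdef
  have hK : ContDiffOn ℝ ∞ K (M.times ×ˢ M.particles) :=
    hκ.comp contDiffOn_spaceTime fun q hq => mem_tube hq.1 hq.2
  obtain ⟨χ, hχ, -, hχ2⟩ := exists_primitive_first M.times_open M.times_interval M.zero_mem
    M.particles_open hK
  refine ⟨χ, hχ, fun t ht a ha => ?_⟩
  have h0 : labelForm M u (0, a) = flat (u 0) a := by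
    have h1 : fderiv ℝ (M.X 0) a = ContinuousLinearMap.id ℝ E3 := by
      refine ((hasFDerivAt_id a).congr_of_eventuallyEq ?_).fderiv
      filter_upwards [M.particles_open.mem_nhds ha] with b hb using M.initial b hb
    simp only [labelForm, h1, M.initial a ha, ContinuousLinearMap.comp_id]
  rw [← h0]
  refine hχ2 (labelForm M u) (fun t ht a ha => ?_) t ht a ha
  have hx : (t, M.X t a) ∈ M.region := mem_tube ht ha
  have hu : DifferentiableAt ℝ (uncurry u) (t, M.X t a) :=
    (hflow.smooth_velocity.contDiffAt (isOpen_region.mem_nhds hx)).differentiableAt (by simp)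
  have h1 := hasDerivAt_along hu (hflow.velocity t ht a ha) rfl
  have h2 : HasDerivAt (fun s => flat (u s) (M.X s a)) _ t :=
    (innerSL ℝ (E := E3)).hasFDerivAt.comp_hasDerivAt t h1
  have h3 := h2.clm_comp (hflow.hasDerivAt_fderiv_X ht ha)
  refine HasDerivAt.congr_deriv h3 (ContinuousLinearMap.ext fun k => ?_)
  have hKd : DifferentiableAt ℝ (uncurry fun s b => K (s, b)) (t, a) :=
    (hK.contDiffAt (hO.mem_nhds ⟨ht, ha⟩)).differentiableAt (by simp)
  have h4 : (fderiv ℝ K (t, a)).comp (ContinuousLinearMap.inr ℝ ℝ E3) =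
      fderiv ℝ (fun b => K (t, b)) a := (hasFDerivAt_uncurry_snd hKd).fderiv.symm
  have hs : ∀ {f : ℝ → E3 → ℝ}, ContDiffOn ℝ ∞ (uncurry f) M.region →
      HasFDerivAt (f t) (fderiv ℝ (f t) (M.X t a)) (M.X t a) := fun hf =>
    ((contDiffAt_slice M.particles_open Subset.rfl hf hx).differentiableAt (by simp)).hasFDerivAt
  have hut := (hflow.differentiableAt_velocity hx).hasFDerivAt
  have h5 : HasFDerivAt (κ t) _ (M.X t a) :=
    ((hs hflow.smooth_potential).sub (hs hP)).add ((hut.inner ℝ hut).const_mul (1 / 2))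
  have h6 : HasFDerivAt (fun b => K (t, b)) _ a := h5.comp a (hasFDerivAt_X ht ha)
  rw [h4, h6.fderiv]
  -- Euler's equation paired with the vector DX_t k; since dp = ϱ dP, the factor ϱ > 0 cancels.
  have h7 := congrArg (fun z : E3 => inner ℝ z (fderiv ℝ (M.X t) a k)) (hflow.euler t _ hx)
  simp only [inner_add_left, inner_sub_left, inner_smul_left, inner_zero_left,
    inner_gradient_eq_fderiv, hpP t _ hx, conj_trivial, smul_apply, smul_eq_mul] at h7
  have h8 := (hflow.density_pos t _ hx).ne'
  have h9 : inner ℝ (deriv (fun s => u s (M.X t a)) t) (fderiv ℝ (M.X t) a k) +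
      inner ℝ (fderiv ℝ (u t) (M.X t a) (u t (M.X t a))) (fderiv ℝ (M.X t) a k) =
      fderiv ℝ (V t) (M.X t a) (fderiv ℝ (M.X t) a k) -
        fderiv ℝ (P t) (M.X t a) (fderiv ℝ (M.X t) a k) := by
    apply mul_left_cancel₀ h8
    linear_combination h7
  simp only [ContinuousLinearMap.comp_apply, add_apply, sub_apply, smul_apply, flat_apply,
    smul_eq_mul, fderivInnerCLM_apply, ContinuousLinearMap.prod_apply]
  change inner ℝ (deriv (fun s => u s (M.X t a)) t + fderiv ℝ (u t) (M.X t a) (u t (M.X t a)))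
    (fderiv ℝ (M.X t) a k) + _ = _
  rw [inner_add_left, h9, real_inner_comm (u t (M.X t a)) (fderiv ℝ (u t) (M.X t a) (fderiv ℝ (M.X t) a k))]
  ring

end IsIdealFlow

theorem divergence_congr {v w : E3 → E3} {x : E3} (h : v =ᶠ[𝓝 x] w) :
    divergence v x = divergence w x := by
  simp only [divergence, partialD, h.fderiv_eq]

namespace IsIdealFlow

variable {M : FluidMotion} {u : ℝ → E3 → E3} {ρ p V : ℝ → E3 → ℝ}

theorem contDiffOn_initial_velocity (hflow : IsIdealFlow M u ρ p V) :
    ContDiffOn ℝ ∞ (u 0) M.particles := by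
  intro a ha
  have h : (0, a) ∈ M.region := ⟨M.zero_mem, a, ha, M.initial a ha⟩
  exact (contDiffAt_slice M.particles_open Subset.rfl hflow.smooth_velocity h).contDiffWithinAt

/-- The vorticity form is carried along by the motion. -/
theorem extD_flat_velocity (hflow : IsIdealFlow M u ρ p V)
    (hlaw : IsLiquid M ρ ∨ IsElastic M ρ p) {t : ℝ} (ht : t ∈ M.times) {a : E3}
    (ha : a ∈ M.particles) (h k : E3) :
    extD (flat (u t)) (M.X t a) (fderiv ℝ (M.X t) a h) (fderiv ℝ (M.X t) a k) =
      extD (flat (u 0)) a h k := by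
  obtain ⟨χ, hχ, hd⟩ := hflow.exists_weber_potential hlaw
  have hχt : ContDiffAt ℝ ∞ (fun b => χ (t, b)) a :=
    (hχ.contDiffAt ((M.times_open.prod M.particles_open).mem_nhds
      (show (t, a) ∈ M.times ×ˢ M.particles from ⟨ht, ha⟩))).comp a
      (contDiffAt_const.prodMk contDiffAt_id)
  have h0 : DifferentiableAt ℝ (u 0) a := (hflow.contDiffOn_initial_velocity.contDiffAt
    (M.particles_open.mem_nhds ha)).differentiableAt (by simp)
  have hut := hflow.differentiableAt_velocity (mem_tube ht ha)
  rw [← extD_pullback (contDiffAt_X ht ha) (hasFDerivAt_flat hut).differentiableAt,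
    extD_congr (β := fun b => flat (u 0) b + fderiv ℝ (fun b => χ (t, b)) b),
    extD_add (hasFDerivAt_flat h0).differentiableAt
      ((hχt.fderiv_right (m := ∞) (by simp)).differentiableAt (by simp)), extD_fderiv hχt, add_zero]
  filter_upwards [M.particles_open.mem_nhds ha] with b hb
  rw [(hd t ht b hb).fderiv, add_sub_cancel]
  rfl

/-- The curl vanishes together with the vorticity form, and the forms at times t and 0 correspond
under the invertible map DX_t. -/
theorem curl_velocity_eq_zero_iff (hflow : IsIdealFlow M u ρ p V)
    (hlaw : IsLiquid M ρ ∨ IsElastic M ρ p) {t : ℝ} (ht : t ∈ M.times) {a : E3}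
    (ha : a ∈ M.particles) : curl (u t) (M.X t a) = 0 ↔ curl (u 0) a = 0 := by
  have h0 : DifferentiableAt ℝ (u 0) a := (hflow.contDiffOn_initial_velocity.contDiffAt
    (M.particles_open.mem_nhds ha)).differentiableAt (by simp)
  have hut := hflow.differentiableAt_velocity (mem_tube ht ha)
  obtain ⟨A, hA⟩ := exists_equiv_fderiv ht ha
  constructor
  · intro h
    refine curl_eq_zero_of_extD h0 fun k l => ?_
    rw [← hflow.extD_flat_velocity hlaw ht ha, extD_flat_eq_curl hut, h]
    simp
  · intro h
    refine curl_eq_zero_of_extD hut fun k l => ?_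
    have := hflow.extD_flat_velocity hlaw ht ha (A.symm k) (A.symm l)
    rw [← hA] at this
    simp only [ContinuousLinearEquiv.coe_coe, ContinuousLinearEquiv.apply_symm_apply] at this
    rw [this, extD_flat_eq_curl h0, h]
    simp

/-- In a liquid the velocity is free of divergence. -/
theorem divergence_velocity_eq_zero (hflow : IsIdealFlow M u ρ p V) (hliq : IsLiquid M ρ) {t : ℝ}
    {x : E3} (hx : (t, x) ∈ M.region) : divergence (u t) x = 0 := by
  obtain ⟨ρ₀, hρ⟩ := hliq
  have h1 := hflow.continuity t x hx
  have h2 : deriv (fun s => ρ s x) t = 0 := by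
    have : (fun s => ρ s x) =ᶠ[𝓝 t] fun _ => ρ₀ := by
      have hc : ContinuousAt (fun s : ℝ => (s, x)) t := by fun_prop
      filter_upwards [hc.eventually (isOpen_region.mem_nhds hx)] with s hs using hρ s x hs
    rw [this.deriv_eq, deriv_const]
  have h3 : (fun y => ρ t y • u t y) =ᶠ[𝓝 x] fun y => ρ₀ • u t y := by
    filter_upwards [eventually_mem_image M.particles_open Subset.rfl hx] with y hy
    rw [hρ t y hy]
  rw [h2, zero_add, divergence_congr h3] at h1
  have h4 : divergence (fun y => ρ₀ • u t y) x = ρ₀ * divergence (u t) x := by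
    simp only [divergence, partialD, fderiv_fun_const_smul (hflow.differentiableAt_velocity hx) ρ₀,
      Finset.mul_sum]
    simp
  rw [h4] at h1
  have h5 := hflow.density_pos t x hx
  rw [hρ t x hx] at h5
  exact (mul_eq_zero.1 h1).resolve_left h5.ne'

end IsIdealFlow

/-! ### Vortex lines as level curves, and the final assembly. -/

/-- A vector in the kernel of a nonzero α ∧ β is annihilated by α and by β. It makes φ and ψ
constant along vortex lines. -/
theorem eq_zero_of_wedge_eq_zero {E : Type*} {α β : E → ℝ} {g k l : E}
    (h : ∀ k, α g * β k - α k * β g = 0) (hkl : α k * β l - α l * β k ≠ 0) :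
    α g = 0 ∧ β g = 0 := by
  constructor
  · refine (mul_eq_zero.1 ?_).resolve_right hkl
    linear_combination α k * h l - α l * h k
  · refine (mul_eq_zero.1 ?_).resolve_right hkl
    linear_combination β k * h l - β l * h k

theorem clebschField_eq_of_flat {F φ ψ : ℝ → E3 → ℝ} {v : E3 → E3} {t : ℝ} {x : E3}
    (h : flat v x = fderiv ℝ (F t) x + φ t x • fderiv ℝ (ψ t) x) : v x = clebschField F φ ψ t x := by
  refine ext_inner_right ℝ fun k => ?_
  rw [← flat_apply, h, clebschField, inner_add_left, inner_smul_left, inner_gradient_eq_fderiv,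
    inner_gradient_eq_fderiv]
  rfl

/-- The potentials of a Clebsch representation are the equations of the vortex lines in a region
where their common level sets are regular curves. -/
theorem areEquationsOfVortexLines_of_clebsch {R : Set E3} (hR : IsOpen R) {v : E3 → E3}
    {F φ ψ : E3 → ℝ} (hv : ∀ x ∈ R, DifferentiableAt ℝ v x) (hcurl : ∀ x ∈ R, curl v x ≠ 0)
    (hF : ContDiffOn ℝ ∞ F R) (hφ : ContDiffOn ℝ ∞ φ R) (hψ : ContDiffOn ℝ ∞ ψ R)
    (h : ∀ x ∈ R, flat v x = fderiv ℝ F x + φ x • fderiv ℝ ψ x)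
    (hlevel : ∀ x ∈ R, ∀ y ∈ R, φ x = φ y → ψ x = ψ y → ∃ γ : ℝ → E3, ContDiff ℝ 1 γ ∧
      (∀ s, γ s ∈ R ∧ deriv γ s ≠ 0 ∧ φ (γ s) = φ x ∧ ψ (γ s) = ψ x) ∧
      x ∈ range γ ∧ y ∈ range γ) :
    AreEquationsOfVortexLines v R φ ψ := by
  have hext : ∀ x ∈ R, ∀ k l, extD (flat v) x k l =
      fderiv ℝ φ x k * fderiv ℝ ψ x l - fderiv ℝ φ x l * fderiv ℝ ψ x k := fun x hx k l =>
    extD_clebsch (hF.contDiffAt (hR.mem_nhds hx)) (hφ.contDiffAt (hR.mem_nhds hx))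
      (hψ.contDiffAt (hR.mem_nhds hx)) (eventually_of_mem (hR.mem_nhds hx) h) k l
  have hcomp : ∀ {g : E3 → ℝ}, ContDiffOn ℝ ∞ g R → ∀ {γ : ℝ → E3}, ContDiff ℝ 1 γ →
      (∀ s, γ s ∈ R) → ∀ s, HasDerivAt (fun s => g (γ s)) (fderiv ℝ g (γ s) (deriv γ s)) s :=
    fun hg γ hγ hγR s => ((hg.contDiffAt (hR.mem_nhds (hγR s))).differentiableAt
      (by simp)).hasFDerivAt.comp_hasDerivAt s (hγ.differentiable one_ne_zero s).hasDerivAt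
  intro x hx y hy
  constructor
  · rintro ⟨h1, h2⟩
    obtain ⟨γ, hγ, hγR, hxγ, hyγ⟩ := hlevel x hx y hy h1 h2
    refine ⟨γ, ⟨hγ, fun s => ⟨(hγR s).1, (hγR s).2.1, ?_⟩⟩, hxγ, hyγ⟩
    -- The tangent of a level curve is annihilated by dφ and dψ, hence lies in the kernel of dφ ∧ dψ
    -- = d(v♭), which is the line of the curl.
    refine exists_eq_smul_curl (hv _ (hγR s).1) (hcurl _ (hγR s).1) fun k => ?_
    have h3 := (hcomp hφ hγ (fun s => (hγR s).1) s).unique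
      ((hasDerivAt_const s (φ x)).congr_of_eventuallyEq (.of_forall fun r => (hγR r).2.2.1))
    have h4 := (hcomp hψ hγ (fun s => (hγR s).1) s).unique
      ((hasDerivAt_const s (ψ x)).congr_of_eventuallyEq (.of_forall fun r => (hγR r).2.2.2))
    rw [hext _ (hγR s).1, h3, h4]
    ring
  · rintro ⟨γ, ⟨hγ, hγR⟩, ⟨r, rfl⟩, ⟨r', rfl⟩⟩
    have hz : ∀ s, fderiv ℝ φ (γ s) (deriv γ s) = 0 ∧ fderiv ℝ ψ (γ s) (deriv γ s) = 0 := by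
      intro s
      obtain ⟨hs, -, c, hc⟩ := hγR s
      obtain ⟨k, l, hkl⟩ : ∃ k l, extD (flat v) (γ s) k l ≠ 0 := by
        by_contra! hcon
        exact hcurl _ hs (curl_eq_zero_of_extD (hv _ hs) hcon)
      rw [hext _ hs] at hkl
      refine eq_zero_of_wedge_eq_zero (fun k => ?_) hkl
      rw [← hext _ hs, hc]
      exact extD_flat_smul_curl (hv _ hs) c k
    have hγR' := fun s => (hγR s).1
    exact ⟨is_const_of_deriv_eq_zero (fun s => (hcomp hφ hγ hγR' s).differentiableAt)
        (fun s => by rw [(hcomp hφ hγ hγR' s).deriv, (hz s).1]) r r',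
      is_const_of_deriv_eq_zero (fun s => (hcomp hψ hγ hγR' s).differentiableAt)
        (fun s => by rw [(hcomp hψ hγ hγR' s).deriv, (hz s).2]) r r'⟩

theorem mainTheorem5 (M : FluidMotion) (u : ℝ → E3 → E3) (ρ p V : ℝ → E3 → ℝ)
    (hflow : IsIdealFlow M u ρ p V) (hlaw : IsLiquid M ρ ∨ IsElastic M ρ p)
    (t₀ : ℝ) (ht₀ : t₀ ∈ M.times) (a₀ : E3) (ha₀ : a₀ ∈ M.particles)
    (hrot : curl (u t₀) (M.X t₀ a₀) ≠ 0) :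
    ∃ U : Set E3, IsOpen U ∧ a₀ ∈ U ∧ U ⊆ M.particles ∧
      ∃ F φ ψ : ℝ → E3 → ℝ,
        ContDiffOn ℝ ∞ (Function.uncurry F) (M.tube U) ∧
        ContDiffOn ℝ ∞ (Function.uncurry φ) (M.tube U) ∧
        ContDiffOn ℝ ∞ (Function.uncurry ψ) (M.tube U) ∧
        -- the representation of the velocity
        (∀ t x, (t, x) ∈ M.tube U → u t x = clebschField F φ ψ t x) ∧
        -- at every time the vortex lines are given by `φ = const`, `ψ = const`
        (∀ t ∈ M.times, AreEquationsOfVortexLines (u t) (M.X t '' U) (φ t) (ψ t)) ∧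
        -- `φ` and `ψ` do not change along the motion
        (∀ t ∈ M.times, ∀ a ∈ U,
          HasDerivAt (fun s => φ s (M.X s a)) 0 t ∧ HasDerivAt (fun s => ψ s (M.X s a)) 0 t) ∧
        -- the transformed equations for `φ` and `ψ`
        (∀ t x, (t, x) ∈ M.tube U →
          deriv (fun s => φ s x) t + inner ℝ (∇ (φ t) x) (clebschField F φ ψ t x) = 0 ∧
          deriv (fun s => ψ s x) t + inner ℝ (∇ (ψ t) x) (clebschField F φ ψ t x) = 0) ∧
        -- the transformed density equation
        (∀ t x, (t, x) ∈ M.tube U →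
          deriv (fun s => ρ s x) t
            + divergence (fun y => ρ t y • clebschField F φ ψ t y) x = 0) ∧
        -- its form for a liquid
        (IsLiquid M ρ → ∀ t x, (t, x) ∈ M.tube U → divergence (clebschField F φ ψ t) x = 0) := by
  have htop : (∞ : WithTop ℕ∞) ≠ 0 := by simp
  have hrot₀ : curl (u 0) a₀ ≠ 0 := fun h =>
    hrot ((hflow.curl_velocity_eq_zero_iff hlaw ht₀ ha₀).2 h)
  obtain ⟨U, f, φ₀, ψ₀, hU, ha₀U, hUM, hf, hφ₀, hψ₀, hcurl, hflat, hlevel⟩ :=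
    exists_local_clebsch M.particles_open hflow.contDiffOn_initial_velocity ha₀ hrot₀
  obtain ⟨χ, hχ, hχd⟩ := hflow.exists_weber_potential hlaw
  have hO := isOpen_tube hU hUM
  have hlabel : ContDiffOn ℝ ∞ M.label (M.tube U) := contDiffOn_label.mono (tube_mono hUM)
  -- The potentials of time 0 are attached to the particles; the exact change χ_t of the pulled back
  -- form is absorbed into F.
  set F : ℝ → E3 → ℝ := fun t x => f (M.label (t, x)) + χ (t, M.label (t, x)) with hFdef
  set φ : ℝ → E3 → ℝ := fun t x => φ₀ (M.label (t, x)) with hφdef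
  set ψ : ℝ → E3 → ℝ := fun t x => ψ₀ (M.label (t, x)) with hψdef
  have hF : ContDiffOn ℝ ∞ (uncurry F) (M.tube U) :=
    (hf.comp hlabel fun q hq => label_mem hUM hq).add
      (hχ.comp (contDiffOn_fst.prodMk hlabel) fun q hq => ⟨hq.1, hUM (label_mem hUM hq)⟩)
  have hφ : ContDiffOn ℝ ∞ (uncurry φ) (M.tube U) :=
    hφ₀.comp hlabel fun q hq => label_mem hUM hq
  have hψ : ContDiffOn ℝ ∞ (uncurry ψ) (M.tube U) :=
    hψ₀.comp hlabel fun q hq => label_mem hUM hq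
  have hφX : ∀ t ∈ M.times, ∀ a ∈ U, φ t (M.X t a) = φ₀ a := fun t ht a ha => by
    simp only [hφdef, label_X ht (hUM ha)]
  have hψX : ∀ t ∈ M.times, ∀ a ∈ U, ψ t (M.X t a) = ψ₀ a := fun t ht a ha => by
    simp only [hψdef, label_X ht (hUM ha)]
  have hFX : ∀ t ∈ M.times, ∀ a ∈ U, F t (M.X t a) = f a + χ (t, a) := fun t ht a ha => by
    simp only [hFdef, label_X ht (hUM ha)]
  have hrep : ∀ t x, (t, x) ∈ M.tube U →
      flat (u t) x = fderiv ℝ (F t) x + φ t x • fderiv ℝ (ψ t) x := by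
    intro t x hx
    obtain ⟨ht, a, ha, rfl⟩ : t ∈ M.times ∧ ∃ a ∈ U, M.X t a = x := hx
    have hx := mem_tube ht ha
    have hX := hasFDerivAt_X ht (hUM ha)
    have hFd := ((contDiffAt_slice hU hUM hF hx).differentiableAt htop).hasFDerivAt.comp a hX
    have hψd := ((contDiffAt_slice hU hUM hψ hx).differentiableAt htop).hasFDerivAt.comp a hX
    have hfa := ((hf.contDiffAt (hU.mem_nhds ha)).differentiableAt htop).hasFDerivAt
    have hψa := ((hψ₀.contDiffAt (hU.mem_nhds ha)).differentiableAt htop).hasFDerivAt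
    have h1 := hFd.unique ((hfa.add (hχd t ht a (hUM ha))).congr_of_eventuallyEq
      (eventually_of_mem (hU.mem_nhds ha) (hFX t ht)))
    have h2 := hψd.unique (hψa.congr_of_eventuallyEq
      (eventually_of_mem (hU.mem_nhds ha) (hψX t ht)))
    obtain ⟨A, hA⟩ := exists_equiv_fderiv ht (hUM ha)
    -- The representation is checked after pullback to labels, where it reads u_0♭ + dχ_t = d(f +
    -- χ_t) + φ₀ dψ₀; invertibility of DX_t then removes the pullback.
    have h3 : (flat (u t) (M.X t a)).comp (fderiv ℝ (M.X t) a) = (fderiv ℝ (F t) (M.X t a) +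
        φ t (M.X t a) • fderiv ℝ (ψ t) (M.X t a)).comp (fderiv ℝ (M.X t) a) := by
      rw [ContinuousLinearMap.add_comp, ContinuousLinearMap.smul_comp, h1, h2, hφX t ht a ha,
        hflat a ha]
      change IsIdealFlow.labelForm M u (t, a) = _
      abel
    refine ContinuousLinearMap.ext fun k => ?_
    have h4 := DFunLike.congr_fun h3 (A.symm k)
    rw [← hA] at h4
    simpa only [ContinuousLinearMap.comp_apply, ContinuousLinearEquiv.coe_coe,
      ContinuousLinearEquiv.apply_symm_apply] using h4
  have hfield : ∀ t x, (t, x) ∈ M.tube U → u t x = clebschField F φ ψ t x := fun t x hx =>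
    clebschField_eq_of_flat (hrep t x hx)
  have hconst : ∀ {g : ℝ → E3 → ℝ} {g₀ : E3 → ℝ}, (∀ t ∈ M.times, ∀ a ∈ U, g t (M.X t a) = g₀ a) →
      ∀ t ∈ M.times, ∀ a ∈ U, HasDerivAt (fun s => g s (M.X s a)) 0 t :=
    fun hg t ht a ha => (hasDerivAt_const t _).congr_of_eventuallyEq
      (eventually_of_mem (M.times_open.mem_nhds ht) fun s hs => hg s hs a ha)
  have htransport : ∀ {g : ℝ → E3 → ℝ} {g₀ : E3 → ℝ}, ContDiffOn ℝ ∞ (uncurry g) (M.tube U) →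
      (∀ t ∈ M.times, ∀ a ∈ U, g t (M.X t a) = g₀ a) → ∀ t x, (t, x) ∈ M.tube U →
      deriv (fun s => g s x) t + inner ℝ (∇ (g t) x) (clebschField F φ ψ t x) = 0 := by
    intro g g₀ hg hgX t x hx
    obtain ⟨ht, a, ha, rfl⟩ : t ∈ M.times ∧ ∃ a ∈ U, M.X t a = x := hx
    have hx := mem_tube ht ha
    have h1 := hasDerivAt_along ((hg.contDiffAt (hO.mem_nhds hx)).differentiableAt htop)
      (hflow.velocity t ht a (hUM ha)) rfl
    rw [inner_gradient_eq_fderiv, ← hfield _ _ hx]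
    exact h1.unique (hconst hgX t ht a ha)
  have hnear : ∀ {t x}, (t, x) ∈ M.tube U → u t =ᶠ[𝓝 x] clebschField F φ ψ t := fun hx =>
    (eventually_mem_image hU hUM hx).mono fun y hy => hfield _ y hy
  refine ⟨U, hU, ha₀U, hUM, F, φ, ψ, hF, hφ, hψ, hfield, fun t ht => ?_,
    fun t ht a ha => ⟨hconst hφX t ht a ha, hconst hψX t ht a ha⟩,
    fun t x hx => ⟨htransport hφ hφX t x hx, htransport hψ hψX t x hx⟩, fun t x hx => ?_,
    fun hliq t x hx => ?_⟩
  · have hmem : ∀ x, x ∈ M.X t '' U → (t, x) ∈ M.tube U := fun x hx => ⟨ht, hx⟩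
    have hR : IsOpen (M.X t '' U) := by
      rw [isOpen_iff_mem_nhds]
      exact fun x hx => (eventually_mem_image hU hUM (hmem x hx)).mono fun y hy => hy.2
    have hs : ∀ {g : ℝ → E3 → ℝ}, ContDiffOn ℝ ∞ (uncurry g) (M.tube U) →
        ContDiffOn ℝ ∞ (g t) (M.X t '' U) := fun hg x hx =>
      (contDiffAt_slice hU hUM hg (hmem x hx)).contDiffWithinAt
    refine areEquationsOfVortexLines_of_clebsch hR
      (fun x hx => hflow.differentiableAt_velocity (tube_mono hUM (hmem x hx))) ?_
      (hs hF) (hs hφ) (hs hψ) (fun x hx => hrep t x (hmem x hx)) ?_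
    · rintro _ ⟨a, ha, rfl⟩ h
      exact hcurl a ha ((hflow.curl_velocity_eq_zero_iff hlaw ht (hUM ha)).1 h)
    · rintro _ ⟨a, ha, rfl⟩ _ ⟨b, hb, rfl⟩ h1 h2
      rw [hφX t ht a ha, hφX t ht b hb] at h1
      rw [hψX t ht a ha, hψX t ht b hb] at h2
      obtain ⟨γ, hγ, hγU, ⟨r, hr⟩, ⟨r', hr'⟩⟩ := hlevel a ha b hb h1 h2
      -- The level curve of φ₀, ψ₀ through the two labels is moved by X_t. It remains regular
      -- because DX_t is injective, and φ and ψ keep their values on it.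
      refine ⟨fun s => M.X t (γ s), ?_, fun s => ⟨⟨γ s, (hγU s).1, rfl⟩, ?_, ?_, ?_⟩,
        ⟨r, by simp only [hr]⟩, ⟨r', by simp only [hr']⟩⟩
      · rw [contDiff_iff_contDiffAt]
        exact fun s => ((contDiffAt_X ht (hUM (hγU s).1)).comp s hγ.contDiffAt).of_le (by simp)
      · have h3 : HasDerivAt (fun s => M.X t (γ s)) _ s :=
          (hasFDerivAt_X ht (hUM (hγU s).1)).comp_hasDerivAt s (hγ.differentiable htop s).hasDerivAt
        obtain ⟨A, hA⟩ := exists_equiv_fderiv ht (hUM (hγU s).1)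
        rw [h3.deriv, ← hA]
        exact fun h => (hγU s).2.1 (A.map_eq_zero_iff.1 h)
      · rw [hφX t ht _ (hγU s).1, hφX t ht a ha]; exact (hγU s).2.2.1
      · rw [hψX t ht _ (hγU s).1, hψX t ht a ha]; exact (hγU s).2.2.2
  · rw [← hflow.continuity t x (tube_mono hUM hx)]
    congr 1
    exact divergence_congr ((hnear hx).symm.mono fun y hy => by simp only [hy])
  · rw [← hflow.divergence_velocity_eq_zero hliq (tube_mono hUM hx)]
    exact divergence_congr (hnear hx).symm

end
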